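/- **Setting.** Let $V\ge 1$ agents play a $K$-armed bandit, $K\ge 2$, for $T\ge 1$ rounds. Let $\nu$ be a probability distribution on $[0,1]^K$ with means $\mu_k$; put $\Delta_k=\max_j\mu_j-\mu_k$ and let $\Delta=\min_{\Delta_k>0}\Delta_k$ be the smallest positive gap. In round $t$ each agent $v$ has a reward vector $(r_{v,t}(k))_{k\in[K]}\sim\nu$, independent over agents and of the past. An adaptive adversary, who knows the past and all the reward vectors of round $t$, replaces them by corrupted vectors $\widetilde r_{v,t}\in[0,1]^K$; then each agent $v$ pulls an arm $I_{v,t}$ and observes $\widetilde r_{v,t}(I_{v,t})$. The corruption level is $C=\mathbb E\big[\sum_{t=1}^T\sum_{v}\max_k|\widetilde r_{v,t}(k)-r_{v,t}(k)|\big]$ (in particular it is at most any almost sure corruption budget), and the individual regret of agent $v$ is $R_v(T)=\max_k\mathbb E\big[\sum_{t=1}^T r_{v,t}(k)\big]-\mathbb E\big[\sum_{t=1}^T r_{v,t}(I_{v,t})\big]$. The communication cost is the number of pairs (agent $v$, round $t\le T$) such that $v$ broadcasts a message in round $t$. **Algorithm (MA-BARBAT).** Put $T_0=0$, $\Delta_k^0=1$,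 $r_k^0=0$. For epochs $m=1,2,\dots$ let $\zeta_m=(m+4)2^{2(m+4)}\ln(VK)$, $\delta_m=1/(VK\zeta_m)$, $\lambda_m=2^8\ln(4K/\delta_m)/V$, $\beta_m=\delta_m/(VK)$, $n_k^m=\lambda_m(\Delta_k^{m-1})^{-2}$, $N_m=\lceil K\lambda_m2^{2(m-1)}\rceil$, $T_m=T_{m-1}+N_m$; let $k_m$ be the smallest maximizer of $k\mapsto r_k^{m-1}$, and let $\widetilde n_k^m=n_k^m$ for $k\ne k_m$, $\widetilde n_{k_m}^m=N_m-\sum_{k\ne k_m}n_k^m$. In each round $T_{m-1}<t\le T_m$ every agent draws its arm from $p_m(k)=\widetilde n_k^m/N_m$, independently of the other agents and of the rewards and corruptions of the round, given the past. At the end of round $T_m$ each agent $v$ broadcasts the sums $S_{v,k}^m$ of the corrupted rewards it observed on each arm $k$ during the epoch, and all agents set $r_k^m=\min\{\sum_vS_{v,k}^m/(V\widetilde n_k^m),1\}$, $r_*^m=\max_k\{r_k^m-\sqrt{4\ln(4/\beta_m)/(V\widetilde n_k^m)}\}$ and $\Delta_k^m=\max\{2^{-m},r_*^m-r_k^m\}$.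 **Theorem.** The communication cost of MA-BARBAT over $T$ rounds is at most $V\log(VT)$. Moreover, with $$\mathcal B=\frac{C}{V}+\sum_{\Delta_k>0}\frac{\log(VT)\log(KVT)}{V\Delta_k}+\frac{K\log(1/\Delta)\log(KV/\Delta)}{V\Delta}$$ (the last term being $0$ if no gap is positive), there is a universal constant $c>0$, independent of $V,K,T,\nu$, the adversary and the agent, such that every agent $v$ satisfies $R_v(T)\le c\,(1+\mathcal B)$ for all $T\ge1$, and $R_v(T)\le c\,\mathcal B$ whenever $T$ is large enough that $\log(VT)\log(KVT)\ge V$. -/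

import Mathlib

open MeasureTheory ProbabilityTheory

noncomputable section

namespace MABarbat

/-! ### Deterministic parameters of MA-BARBAT

`V` is the number of agents, `K` the number of arms, and epochs are numbered `m = 1, 2, …`. -/

/-- `ζ_m = (m + 4) 2^{2(m+4)} ln(VK)`. -/
def zeta (V K m : ℕ) : ℝ :=
  ((m : ℝ) + 4) * 2 ^ (2 * (m + 4)) * Real.log ((V : ℝ) * K)

/-- `δ_m = 1 / (VK ζ_m)`. -/
def delta (V K m : ℕ) : ℝ := 1 / ((V : ℝ) * K * zeta V K m)

/-- `λ_m = 2^8 ln(4K / δ_m) / V`. -/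
def lam (V K m : ℕ) : ℝ := 2 ^ 8 * Real.log (4 * K / delta V K m) / V

/-- `β_m = δ_m / (VK)`. -/
def beta (V K m : ℕ) : ℝ := delta V K m / ((V : ℝ) * K)

/-- The epoch length `N_m = ⌈K λ_m 2^{2(m-1)}⌉`, for `m ≥ 1`. -/
def epochLen (V K m : ℕ) : ℕ := ⌈(K : ℝ) * lam V K m * 2 ^ (2 * (m - 1))⌉₊

/-- `T_0 = 0` and `T_m = T_{m-1} + N_m`. -/
def endTime (V K : ℕ) : ℕ → ℕ
  | 0 => 0
  | m + 1 => endTime V K m + epochLen V K (m + 1)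

/-! ### The state of the algorithm and its update -/

/-- What every agent knows after an epoch: the estimated rewards `r_k^m` and the estimated
gaps `Δ_k^m`. -/
structure State (K : ℕ) where
  est : Fin K → ℝ
  gap : Fin K → ℝ

/-- `r_k^0 = 0` and `Δ_k^0 = 1`. -/
def State.init (K : ℕ) : State K := ⟨fun _ => 0, fun _ => 1⟩

/-- The arm with the largest estimated reward; the smallest index wins ties. -/
def leader {K : ℕ} [NeZero K] (r : Fin K → ℝ) : Fin K :=
  (Finset.univ.filter fun k => ∀ j, r j ≤ r k).min' (by
    obtain ⟨k, hk⟩ := Finite.exists_max r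
    exact ⟨k, by simpa using hk⟩)

/-- `n_k^m = λ_m (Δ_k^{m-1})^{-2}`, where `st` is the state after epoch `m - 1`. -/
def baseCount (V : ℕ) {K : ℕ} (m : ℕ) (st : State K) (k : Fin K) : ℝ :=
  lam V K m / st.gap k ^ 2

/-- `ñ_k^m`: equal to `n_k^m` for `k ≠ k_m`, and to `N_m - ∑_{j ≠ k_m} n_j^m` for `k = k_m`. -/
def pullCount (V : ℕ) {K : ℕ} [NeZero K] (m : ℕ) (st : State K) (k : Fin K) : ℝ :=
  if k = leader st.est then
    (epochLen V K m : ℝ) - ∑ j ∈ Finset.univ.erase (leader st.est), baseCount V m st j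
  else baseCount V m st k

/-- The sampling distribution `p_m(k) = ñ_k^m / N_m` of epoch `m`. -/
def armProb (V : ℕ) {K : ℕ} [NeZero K] (m : ℕ) (st : State K) (k : Fin K) : ℝ :=
  pullCount V m st k / epochLen V K m

/-- `r_k^m = min {∑_v S_{v,k}^m / (V ñ_k^m), 1}`, from the messages `S_{v,k}^m` of epoch `m`. -/
def newEst {V K : ℕ} [NeZero K] (m : ℕ) (st : State K) (msg : Fin V → Fin K → ℝ)
    (k : Fin K) : ℝ :=
  min ((∑ v, msg v k) / (V * pullCount V m st k)) 1

/-- `r_*^m = max_k {r_k^m - √(4 ln(4/β_m) / (V ñ_k^m))}`. -/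
def newStar {V K : ℕ} [NeZero K] (m : ℕ) (st : State K) (msg : Fin V → Fin K → ℝ) : ℝ :=
  Finset.univ.sup' Finset.univ_nonempty fun k : Fin K =>
    newEst m st msg k -
      Real.sqrt (4 * Real.log (4 / beta V K m) / (V * pullCount V m st k))

/-- The state after epoch `m`, from the state after epoch `m - 1` and the messages broadcast at
the end of epoch `m`; `Δ_k^m = max {2^{-m}, r_*^m - r_k^m}`. -/
def State.next {V K : ℕ} [NeZero K] (m : ℕ) (st : State K) (msg : Fin V → Fin K → ℝ) :
    State K where
  est := newEst m st msg
  gap := fun k => max ((1 / 2 : ℝ) ^ m) (newStar m st msg - newEst m st msg k)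

/-- The state after epoch `m`, where `msg m v` is the message of agent `v` in epoch `m`. -/
def stateAfter {V K : ℕ} [NeZero K] (msg : ℕ → Fin V → Fin K → ℝ) : ℕ → State K
  | 0 => State.init K
  | m + 1 => State.next (m + 1) (stateAfter msg m) (msg (m + 1))

/-- The message `S_{v,k}^m` of agent `v` after epoch `m ≥ 1`: the sum of the rewards that `v`
observed on arm `k` during the epoch. Rounds are numbered `t = 0, 1, …`, so that epoch `m` consists
of the rounds `T_{m-1} ≤ t < T_m`. -/
def message {V K : ℕ} (arm : ℕ → Fin V → Fin K) (obs : ℕ → Fin V → ℝ)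
    (m : ℕ) (v : Fin V) (k : Fin K) : ℝ :=
  ∑ t ∈ Finset.Ico (endTime V K (m - 1)) (endTime V K m), if arm t v = k then obs t v else 0

/-! ### Communication -/

/-- In MA-BARBAT an agent broadcasts exactly in the last round of each epoch. -/
def Broadcasts (V K : ℕ) (_v : Fin V) (t : ℕ) : Prop := ∃ m, 1 ≤ m ∧ t + 1 = endTime V K m

open Classical in
/-- The number of pairs (agent, round) with a broadcast, over the first `T` rounds. -/
def commCost (V K T : ℕ) : ℕ :=
  ∑ v : Fin V, ∑ t ∈ Finset.range T, if Broadcasts V K v t then 1 else 0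

/-! ### Corrupted multi-agent bandits -/

/-- A play of `V` agents on a `K`-armed bandit with reward distribution `ν` under an adaptive
adversary. In round `t = 0, 1, …`, the reward vectors of the agents are drawn independently of
each other and of the past from `ν`; the adversary, who knows the past (`past t`) and these
vectors, replaces them by corrupted ones (after which the information is `mid t`);
then each agent `v` pulls `arm t · v`. How arms are chosen is not constrained here. -/
structure Play (V K : ℕ) (ν : Measure (Fin K → ℝ)) {Ω : Type*} [mΩ : MeasurableSpace Ω]
    (P : Measure Ω) where
  reward : ℕ → Ω → Fin V → Fin K → ℝ
  corrupted : ℕ → Ω → Fin V → Fin K → ℝ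
  arm : ℕ → Ω → Fin V → Fin K
  past : ℕ → MeasurableSpace Ω
  mid : ℕ → MeasurableSpace Ω
  past_le_mid : ∀ t, past t ≤ mid t
  mid_le_past : ∀ t, mid t ≤ past (t + 1)
  past_le : ∀ t, past t ≤ mΩ
  measurable_reward : ∀ t, Measurable[mid t] (reward t)
  measurable_corrupted : ∀ t, Measurable[mid t] (corrupted t)
  measurable_arm : ∀ t, Measurable[past (t + 1)] (arm t)
  law_reward : ∀ t, P.map (reward t) = Measure.pi fun _ : Fin V => ν
  indep_reward : ∀ t, Indep (past t) (MeasurableSpace.comap (reward t) inferInstance) P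
  corrupted_mem : ∀ t, ∀ᵐ ω ∂P, ∀ v k, corrupted t ω v k ∈ Set.Icc (0 : ℝ) 1

namespace Play

variable {V K : ℕ} {ν : Measure (Fin K → ℝ)} {Ω : Type*} [MeasurableSpace Ω] {P : Measure Ω}

/-- The messages of the agents in the outcome `ω`; they depend only on the arms pulled and on the
corrupted rewards of these arms. -/
def messages (B : Play V K ν P) (ω : Ω) : ℕ → Fin V → Fin K → ℝ :=
  message (fun t v => B.arm t ω v) (fun t v => B.corrupted t ω v (B.arm t ω v))

/-- The agents follow MA-BARBAT: in each round of epoch `m + 1`, conditionally on everything that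
happened before the choice of arms, they draw their arms independently from `p_{m+1}`. -/
def FollowsMABarbat [NeZero K] (B : Play V K ν P) : Prop :=
  ∀ m t : ℕ, endTime V K m ≤ t → t < endTime V K (m + 1) → ∀ a : Fin V → Fin K,
    P⟦{ω | B.arm t ω = a} | B.mid t⟧ =ᵐ[P]
      fun ω => ∏ v, armProb V (m + 1) (stateAfter (B.messages ω) m) (a v)

/-- The total corruption `∑_t ∑_v max_k |r̃_{v,t}(k) - r_{v,t}(k)|` over the first `T` rounds. -/
def corruption [NeZero K] (B : Play V K ν P) (T : ℕ) (ω : Ω) : ℝ :=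
  ∑ t ∈ Finset.range T, ∑ v, Finset.univ.sup' Finset.univ_nonempty fun k : Fin K =>
    |B.corrupted t ω v k - B.reward t ω v k|

/-- The individual regret
`R_v(T) = max_k 𝔼[∑_t r_{v,t}(k)] - 𝔼[∑_t r_{v,t}(I_{v,t})]`. -/
def regret [NeZero K] (B : Play V K ν P) (v : Fin V) (T : ℕ) : ℝ :=
  (Finset.univ.sup' Finset.univ_nonempty fun k : Fin K =>
      ∫ ω, ∑ t ∈ Finset.range T, B.reward t ω v k ∂P) -
    ∫ ω, ∑ t ∈ Finset.range T, B.reward t ω v (B.arm t ω v) ∂P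

end Play

/-! ### Gaps and the regret bound -/

/-- The mean reward `μ_k`. -/
def mean {K : ℕ} (ν : Measure (Fin K → ℝ)) (k : Fin K) : ℝ := ∫ x, x k ∂ν

/-- The gap `Δ_k = max_j μ_j - μ_k`. -/
def gap {K : ℕ} [NeZero K] (ν : Measure (Fin K → ℝ)) (k : Fin K) : ℝ :=
  (Finset.univ.sup' Finset.univ_nonempty (mean ν)) - mean ν k

/-- The smallest positive gap `Δ` (and `0` if there is none, in which case the last term of
`regretBound` vanishes). -/
def minGap {K : ℕ} [NeZero K] (ν : Measure (Fin K → ℝ)) : ℝ :=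
  sInf {x | 0 < x ∧ ∃ k, gap ν k = x}

/-- `C/V + ∑_{Δ_k > 0} log(VT) log(KVT) / (V Δ_k) + K log(1/Δ) log(KV/Δ) / (V Δ)`. -/
def regretBound (V : ℕ) {K : ℕ} [NeZero K] (ν : Measure (Fin K → ℝ)) (C : ℝ) (T : ℕ) : ℝ :=
  C / V
    + ∑ k : Fin K, (if 0 < gap ν k then
        Real.log ((V : ℝ) * T) * Real.log ((K : ℝ) * V * T) / (V * gap ν k) else 0)
    + (K : ℝ) * Real.log (1 / minGap ν) * Real.log ((K : ℝ) * V / minGap ν) / (V * minGap ν)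

end MABarbat

end

noncomputable section

namespace MABarbat

/-! ### Bounds on the deterministic parameters -/

/-! Communication: `V` times the length of epoch `m` is at least `4^m`, so at most `log(VT)` epochs
end within `T` rounds.

Regret: the proof separates a deterministic analysis of one path from a concentration estimate. On a
path, write `e_m` for the error of the epoch-`m` estimates beyond the confidence radius. The choice
of `λ_m` makes the radius at most 9/50 of the previous gap estimate (`radius_le`). The gap
recursions therefore contract: `Δ_k^m` is controlled by `Δ_k + 2^{-m} + ρ_m`, where `ρ_m` is the sum
of past errors discounted by 9/50 per epoch, and either `Δ_k^m ≥ Δ_k/10` or `Δ_k ≤ 20 ρ_m`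
(`gap_lower_or_discounted`). In the first case arm `k` costs `O(λ/Δ_k)` in the epoch; in the second
its cost is charged to `ρ_m`. The leader, which absorbs the rest of the epoch, has true gap
`O(2^{-m} + ρ_m)`. Beyond the part charged to `ρ_m` it costs something only while `2^m Δ < 9/2`, a
geometric sum of order `K log(KV/Δ)/(VΔ)`. Epoch lengths grow by a factor of at most 5 and `5 · 9/50
< 1`, so the discounted errors weighted by epoch lengths sum to a constant times `∑ N_m e_m`
(`sum_epochLen_mul_discounted_le`). `epoch_regret_le` collects these estimates.

The error `e_m` consists of two terms. Corruption shifts the sum for arm `k` by at most `p_m(k)`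
times the epoch's corruption `C_m`, plus a centred term; after division by `V ñ_k = V N_m p_m(k)`
the bias is at most `C_m/(V N_m)` for every arm, however rarely it is pulled, so that `∑ N_m e_m`
produces `C/V`. The other term is the indicator of a large deviation. An exponential supermartingale
that integrates out first the arms, then the rewards, gives this event probability at most `δ_m/2`
(`measureReal_badEvent_le`), and `N_m δ_m/2` is at most `λ_m` plus a summable term. Since all rounds
of an epoch have the same expected regret, for every agent, the sum over epochs bounds the
individual regret (`regret_le_sum_epochs`, `regret_le_of_epochs`). -/

/-- The logarithm `ln(4K / δ_m)` occurring in `λ_m`. -/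
def logTerm (V K m : ℕ) : ℝ := Real.log (4 * K / delta V K m)

/-- The logarithm `ln(4 / β_m)` occurring in the confidence radius. -/
def logBeta (V K m : ℕ) : ℝ := Real.log (4 / beta V K m)

section Parameters

variable {V K : ℕ}

lemma two_le_mul_cast (hV : 1 ≤ V) (hK : 2 ≤ K) : (2 : ℝ) ≤ (V : ℝ) * K := by
  have h1 : (1 : ℝ) ≤ V := by exact_mod_cast hV
  have h2 : (2 : ℝ) ≤ K := by exact_mod_cast hK
  nlinarith

lemma half_lt_log_mul (hV : 1 ≤ V) (hK : 2 ≤ K) : (1 / 2 : ℝ) < Real.log ((V : ℝ) * K) := by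
  have h := Real.log_le_log (by norm_num) (two_le_mul_cast hV hK)
  have := Real.log_two_gt_d9
  linarith

lemma four_pow_le_zeta (hV : 1 ≤ V) (hK : 2 ≤ K) (m : ℕ) : 512 * (4 : ℝ) ^ m ≤ zeta V K m := by
  have h := half_lt_log_mul hV hK
  have e : (2 : ℝ) ^ (2 * (m + 4)) = 256 * 4 ^ m := by
    rw [pow_mul, pow_add]; norm_num; ring
  unfold zeta
  rw [e]
  have hm : (0 : ℝ) ≤ m := Nat.cast_nonneg m
  have h4 : (0 : ℝ) < 4 ^ m := by positivity
  have h5 : (2 : ℝ) ≤ ((m : ℝ) + 4) * Real.log ((V : ℝ) * K) := by nlinarith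
  nlinarith

lemma zeta_pos (hV : 1 ≤ V) (hK : 2 ≤ K) (m : ℕ) : 0 < zeta V K m :=
  lt_of_lt_of_le (by positivity) (four_pow_le_zeta hV hK m)

lemma zeta_succ_le (hV : 1 ≤ V) (hK : 2 ≤ K) (m : ℕ) : zeta V K (m + 1) ≤ 5 * zeta V K m := by
  have h := half_lt_log_mul hV hK
  have e : (2 : ℝ) ^ (2 * (m + 1 + 4)) = 4 * 2 ^ (2 * (m + 4)) := by
    rw [show 2 * (m + 1 + 4) = 2 * (m + 4) + 2 by ring, pow_add]; ring
  unfold zeta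
  rw [e]
  have hm : (0 : ℝ) ≤ m := Nat.cast_nonneg m
  have h2 : (0 : ℝ) < 2 ^ (2 * (m + 4)) * Real.log ((V : ℝ) * K) := by positivity
  push_cast
  nlinarith

lemma zeta_succ_le_pow (hV : 1 ≤ V) (hK : 2 ≤ K) (m : ℕ) :
    zeta V K (m + 1) ≤ 5120 * 8 ^ m * ((V : ℝ) * K) := by
  have h := half_lt_log_mul hV hK
  have h2 := two_le_mul_cast hV hK
  have hlog : Real.log ((V : ℝ) * K) ≤ (V : ℝ) * K := by
    have := Real.log_le_sub_one_of_pos (show (0 : ℝ) < (V : ℝ) * K by linarith)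
    linarith
  have e : (2 : ℝ) ^ (2 * (m + 1 + 4)) = 1024 * 4 ^ m := by
    rw [show 2 * (m + 1 + 4) = 2 * m + 10 by ring, pow_add, pow_mul]; norm_num; ring
  have hm : ((m + 1 : ℕ) : ℝ) + 4 ≤ 5 * 2 ^ m := by
    have : m + 1 ≤ 2 ^ m := Nat.lt_two_pow_self
    have h1 : ((m + 1 : ℕ) : ℝ) ≤ 2 ^ m := by exact_mod_cast this
    have h3 : (1 : ℝ) ≤ 2 ^ m := one_le_pow₀ (by norm_num)
    linarith
  have h8 : (8 : ℝ) ^ m = 2 ^ m * 4 ^ m := by rw [← mul_pow]; norm_num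
  unfold zeta
  rw [e]
  calc (((m + 1 : ℕ) : ℝ) + 4) * (1024 * 4 ^ m) * Real.log ((V : ℝ) * K)
      ≤ (5 * 2 ^ m) * (1024 * 4 ^ m) * ((V : ℝ) * K) := by gcongr
    _ = 5120 * 8 ^ m * ((V : ℝ) * K) := by rw [h8]; ring

lemma delta_pos (hV : 1 ≤ V) (hK : 2 ≤ K) (m : ℕ) : 0 < delta V K m := by
  have := zeta_pos hV hK m
  have := two_le_mul_cast hV hK
  unfold delta
  positivity

lemma beta_pos (hV : 1 ≤ V) (hK : 2 ≤ K) (m : ℕ) : 0 < beta V K m := by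
  have := delta_pos hV hK m
  have := two_le_mul_cast hV hK
  unfold beta
  positivity

lemma logTerm_eq (m : ℕ) : logTerm V K m = Real.log (4 * K * ((V : ℝ) * K * zeta V K m)) := by
  unfold logTerm delta
  rw [div_div_eq_mul_div, div_one]

lemma logBeta_eq (m : ℕ) :
    logBeta V K m = Real.log (4 * (((V : ℝ) * K) * ((V : ℝ) * K * zeta V K m))) := by
  unfold logBeta beta delta
  congr 1
  rw [div_div, div_div_eq_mul_div, div_one]
  ring

lemma pow_five_le (hV : 1 ≤ V) (hK : 2 ≤ K) (m : ℕ) :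
    (5 : ℝ) ^ 4 ≤ 4 * K * ((V : ℝ) * K * zeta V K m) := by
  have h1 := four_pow_le_zeta hV hK m
  have h2 := two_le_mul_cast hV hK
  have hK' : (2 : ℝ) ≤ K := by exact_mod_cast hK
  have h4 : (1 : ℝ) ≤ 4 ^ m := one_le_pow₀ (by norm_num)
  have h3 : (512 : ℝ) ≤ zeta V K m := by linarith
  have h5 : (1024 : ℝ) ≤ (V : ℝ) * K * zeta V K m := by nlinarith
  nlinarith

lemma four_log_five_le_logTerm (hV : 1 ≤ V) (hK : 2 ≤ K) (m : ℕ) :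
    4 * Real.log 5 ≤ logTerm V K m := by
  rw [logTerm_eq]
  have := Real.log_le_log (by norm_num) (pow_five_le hV hK m)
  rwa [Real.log_pow, Nat.cast_ofNat] at this

lemma one_le_logTerm (hV : 1 ≤ V) (hK : 2 ≤ K) (m : ℕ) : 1 ≤ logTerm V K m := by
  have h := four_log_five_le_logTerm hV hK m
  have h2 := Real.log_le_log (by norm_num) (show (2 : ℝ) ≤ 5 by norm_num)
  have := Real.log_two_gt_d9
  linarith

/-- The next epoch multiplies `ζ` by at most 5, which adds `log 5`; by `four_log_five_le_logTerm`
this is at most a quarter of the logarithm. -/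
lemma logTerm_succ_le (hV : 1 ≤ V) (hK : 2 ≤ K) (m : ℕ) :
    logTerm V K (m + 1) ≤ 5 / 4 * logTerm V K m := by
  have h := four_log_five_le_logTerm hV hK m
  have h0 := zeta_pos hV hK m
  have h1 := zeta_pos hV hK (m + 1)
  have h2 := two_le_mul_cast hV hK
  have hK' : (2 : ℝ) ≤ K := by exact_mod_cast hK
  have key : logTerm V K (m + 1) ≤ Real.log 5 + logTerm V K m := by
    rw [logTerm_eq, logTerm_eq, ← Real.log_mul (by norm_num) (by positivity)]
    apply Real.log_le_log (by positivity)
    calc 4 * (K : ℝ) * ((V : ℝ) * K * zeta V K (m + 1))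
        ≤ 4 * (K : ℝ) * ((V : ℝ) * K * (5 * zeta V K m)) := by
          gcongr; exact zeta_succ_le hV hK m
      _ = _ := by ring
  linarith

/-- The argument of the logarithm is at most `20480 (VK)^3 (2^m)^3`. As `VK ≥ 2`, the constant is
absorbed by `(VK)^15`, whence the exponent 18. -/
lemma logTerm_succ_le_log (hV : 1 ≤ V) (hK : 2 ≤ K) (m : ℕ) :
    logTerm V K (m + 1) ≤ 18 * Real.log ((K : ℝ) * V * 2 ^ m) := by
  have h1 := zeta_pos hV hK (m + 1)
  have h2 := two_le_mul_cast hV hK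
  have hV' : (1 : ℝ) ≤ V := by exact_mod_cast hV
  have hK' : (2 : ℝ) ≤ K := by exact_mod_cast hK
  rw [logTerm_eq, ← Nat.cast_ofNat (n := 18), ← Real.log_pow]
  apply Real.log_le_log (by positivity)
  have hp : (1 : ℝ) ≤ 2 ^ m := one_le_pow₀ (by norm_num)
  set x : ℝ := (V : ℝ) * K with hx
  have hKx : (K : ℝ) ≤ x := by nlinarith
  have h15 : (2 : ℝ) ^ 15 ≤ x ^ 15 := by gcongr
  have h8 : (8 : ℝ) ^ m = (2 ^ m) ^ 3 := by rw [← pow_mul, mul_comm, pow_mul]; norm_num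
  calc 4 * (K : ℝ) * (x * zeta V K (m + 1))
      ≤ 4 * x * (x * (5120 * 8 ^ m * x)) := by
        gcongr; exact zeta_succ_le_pow hV hK m
    _ = 20480 * (x ^ 3 * (2 ^ m) ^ 3) := by rw [h8]; ring
    _ ≤ x ^ 15 * (x ^ 3 * (2 ^ m) ^ 18) := by
        gcongr
        · norm_num at h15 ⊢; linarith
        · norm_num
    _ = _ := by rw [hx]; norm_num; ring

lemma logBeta_le (hV : 1 ≤ V) (hK : 2 ≤ K) (m : ℕ) : logBeta V K m ≤ 2 * logTerm V K m := by
  have h0 := four_pow_le_zeta hV hK m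
  have h2 := two_le_mul_cast hV hK
  have hV' : (1 : ℝ) ≤ V := by exact_mod_cast hV
  have hK' : (2 : ℝ) ≤ K := by exact_mod_cast hK
  have h4 : (1 : ℝ) ≤ 4 ^ m := one_le_pow₀ (by norm_num)
  have hz : (1 : ℝ) ≤ zeta V K m := by linarith
  have hsq (y : ℝ) : 2 * Real.log y = Real.log (y ^ 2) := by rw [Real.log_pow]; norm_num
  rw [logTerm_eq, logBeta_eq, hsq]
  apply Real.log_le_log (by positivity)
  set x : ℝ := (V : ℝ) * K with hx
  calc 4 * (x * (x * zeta V K m)) ≤ (4 * K) ^ 2 * (x * (x * (zeta V K m) ^ 2)) := by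
        gcongr
        · nlinarith
        · nlinarith
    _ = _ := by ring

lemma logBeta_pos (hV : 1 ≤ V) (hK : 2 ≤ K) (m : ℕ) : 0 < logBeta V K m := by
  have h0 := four_pow_le_zeta hV hK m
  have h2 := two_le_mul_cast hV hK
  have h4 : (1 : ℝ) ≤ 4 ^ m := one_le_pow₀ (by norm_num)
  have hz : (1 : ℝ) ≤ zeta V K m := by linarith
  rw [logBeta_eq]
  apply Real.log_pos
  have : (1 : ℝ) ≤ (V : ℝ) * K * zeta V K m := by nlinarith
  nlinarith

lemma exp_neg_logBeta (hV : 1 ≤ V) (hK : 2 ≤ K) (m : ℕ) :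
    Real.exp (-logBeta V K m) = beta V K m / 4 := by
  have := beta_pos hV hK m
  rw [Real.exp_neg, logBeta, Real.exp_log (by positivity), inv_div]

lemma lam_eq (m : ℕ) : lam V K m = 256 * logTerm V K m / V := by
  unfold lam logTerm
  norm_num

lemma mul_lam_eq (hV : 1 ≤ V) (m : ℕ) : V * lam V K m = 256 * logTerm V K m := by
  have hV' : (V : ℝ) ≠ 0 := by positivity
  rw [lam_eq]; field_simp

lemma lam_pos (hV : 1 ≤ V) (hK : 2 ≤ K) (m : ℕ) : 0 < lam V K m := by
  have := one_le_logTerm hV hK m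
  have hV' : (0 : ℝ) < V := by positivity
  rw [lam_eq]
  positivity

lemma le_epochLen_succ (m : ℕ) : (K : ℝ) * lam V K (m + 1) * 4 ^ m ≤ epochLen V K (m + 1) := by
  have h : (K : ℝ) * lam V K (m + 1) * 2 ^ (2 * (m + 1 - 1)) ≤ epochLen V K (m + 1) :=
    Nat.le_ceil _
  rw [Nat.add_sub_cancel, pow_mul] at h
  norm_num at h
  exact h

lemma epochLen_succ_le (hV : 1 ≤ V) (hK : 2 ≤ K) (m : ℕ) :
    (epochLen V K (m + 1) : ℝ) ≤ K * lam V K (m + 1) * 4 ^ m + 1 := by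
  have := lam_pos hV hK (m + 1)
  have h : (epochLen V K (m + 1) : ℝ) < (K : ℝ) * lam V K (m + 1) * 2 ^ (2 * (m + 1 - 1)) + 1 :=
    Nat.ceil_lt_add_one (by positivity)
  rw [Nat.add_sub_cancel, pow_mul] at h
  norm_num at h
  exact h.le

lemma epochLen_succ_pos (hV : 1 ≤ V) (hK : 2 ≤ K) (m : ℕ) : 0 < epochLen V K (m + 1) := by
  have := lam_pos hV hK (m + 1)
  have hK' : (0 : ℝ) < K := by positivity
  exact Nat.ceil_pos.mpr (by positivity)

/-- The factor is `4 · 5/4`, from `2^{2(m-1)}` and from `logTerm_succ_le`; rounding up costs nothing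
because the right side is an integer. It must stay below `50/9`, the inverse of the discount rate.
-/
lemma epochLen_succ_succ_le (hV : 1 ≤ V) (hK : 2 ≤ K) (m : ℕ) :
    epochLen V K (m + 2) ≤ 5 * epochLen V K (m + 1) := by
  rw [epochLen, Nat.ceil_le]
  have hl := logTerm_succ_le hV hK (m + 1)
  have hV' : (0 : ℝ) < V := by positivity
  have hlam : lam V K (m + 2) ≤ 5 / 4 * lam V K (m + 1) := by
    rw [lam_eq, lam_eq, show 5 / 4 * (256 * logTerm V K (m + 1) / V) =
      256 * (5 / 4 * logTerm V K (m + 1)) / (V : ℝ) by ring]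
    gcongr
  have h := le_epochLen_succ (V := V) (K := K) m
  have e : (2 : ℝ) ^ (2 * (m + 2 - 1)) = 4 * 4 ^ m := by
    rw [show 2 * (m + 2 - 1) = 2 * m + 2 by omega, pow_add, pow_mul]; norm_num; ring
  rw [e]
  push_cast
  calc (K : ℝ) * lam V K (m + 2) * (4 * 4 ^ m)
      ≤ (K : ℝ) * (5 / 4 * lam V K (m + 1)) * (4 * 4 ^ m) := by gcongr
    _ = 5 * ((K : ℝ) * lam V K (m + 1) * 4 ^ m) := by ring
    _ ≤ _ := by gcongr

lemma endTime_strictMono (hV : 1 ≤ V) (hK : 2 ≤ K) : StrictMono (endTime V K) := by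
  refine strictMono_nat_of_lt_succ fun m => ?_
  have := epochLen_succ_pos hV hK m
  simp only [endTime]
  omega

/-- Holds because `V λ_m ≥ 256`. It bounds the number of epochs begun before `T` by a multiple of
`log(VT)`, for the communication cost and for the regret. -/
lemma four_pow_le_mul_endTime (hV : 1 ≤ V) (hK : 2 ≤ K) {m : ℕ} (hm : 1 ≤ m) :
    (4 : ℝ) ^ m ≤ V * endTime V K m := by
  obtain ⟨m, rfl⟩ : ∃ n, m = n + 1 := ⟨m - 1, by omega⟩
  have hV' : (0 : ℝ) < V := by positivity
  have hK' : (2 : ℝ) ≤ K := by exact_mod_cast hK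
  have h1 : (epochLen V K (m + 1) : ℝ) ≤ endTime V K (m + 1) := by
    simp only [endTime]; push_cast; linarith [Nat.cast_nonneg (α := ℝ) (endTime V K m)]
  have h2 := le_epochLen_succ (V := V) (K := K) m
  have h3 := mul_lam_eq (K := K) hV (m + 1)
  have h4 := one_le_logTerm hV hK (m + 1)
  have h5 : (0 : ℝ) < 4 ^ m := by positivity
  calc (4 : ℝ) ^ (m + 1) = 4 * 4 ^ m := by ring
    _ ≤ K * (256 * logTerm V K (m + 1)) * 4 ^ m := by gcongr; nlinarith
    _ = V * (K * lam V K (m + 1) * 4 ^ m) := by rw [← h3]; ring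
    _ ≤ V * endTime V K (m + 1) := by gcongr; exact h2.trans h1

lemma four_pow_le_mul_of_endTime_lt (hV : 1 ≤ V) (hK : 2 ≤ K) {m T : ℕ}
    (h : endTime V K m < T) : (4 : ℝ) ^ m ≤ V * T := by
  rcases Nat.eq_zero_or_pos m with rfl | hm
  · have : 1 ≤ V * T := Nat.mul_pos hV (by omega)
    simpa using (by exact_mod_cast this : (1 : ℝ) ≤ V * T)
  · refine (four_pow_le_mul_endTime hV hK hm).trans ?_
    gcongr

/-! ### The communication cost -/

lemma commCost_le (hV : 1 ≤ V) (hK : 2 ≤ K) {T : ℕ} (hT : 1 ≤ T) :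
    (commCost V K T : ℝ) ≤ V * Real.log ((V : ℝ) * T) := by
  classical
  have hVT : (1 : ℝ) ≤ (V : ℝ) * T := by exact_mod_cast Nat.mul_pos hV hT
  have hlog : 0 ≤ Real.log ((V : ℝ) * T) := Real.log_nonneg hVT
  have key : ((Finset.range T).filter fun t => ∃ m, 1 ≤ m ∧ t + 1 = endTime V K m).card
      ≤ ⌊Real.log ((V : ℝ) * T)⌋₊ := by
    calc _ ≤ ((Finset.Icc 1 ⌊Real.log ((V : ℝ) * T)⌋₊).image
          fun m => endTime V K m - 1).card := by
          apply Finset.card_le_card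
          intro t ht
          simp only [Finset.mem_filter, Finset.mem_range] at ht
          obtain ⟨htT, m, hm, hmt⟩ := ht
          simp only [Finset.mem_image, Finset.mem_Icc]
          refine ⟨m, ⟨hm, Nat.le_floor ?_⟩, by omega⟩
          rw [Real.le_log_iff_exp_le (by linarith)]
          have h1 := four_pow_le_mul_endTime hV hK hm
          have h2 : (endTime V K m : ℝ) ≤ T := by exact_mod_cast (by omega : endTime V K m ≤ T)
          calc Real.exp m = Real.exp 1 ^ m := by rw [← Real.exp_nat_mul, mul_one]
            _ ≤ 4 ^ m := by
              gcongr
              linarith [Real.exp_one_lt_d9]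
            _ ≤ V * endTime V K m := h1
            _ ≤ V * T := by gcongr
      _ ≤ (Finset.Icc 1 ⌊Real.log ((V : ℝ) * T)⌋₊).card := Finset.card_image_le
      _ = _ := by simp
  have hc : commCost V K T =
      V * ((Finset.range T).filter fun t => ∃ m, 1 ≤ m ∧ t + 1 = endTime V K m).card := by
    unfold commCost Broadcasts
    simp
  rw [hc]
  push_cast
  gcongr
  exact (Nat.cast_le.mpr key).trans (Nat.floor_le hlog)

end Parameters

end MABarbat

end

noncomputable section

namespace MABarbat

/-! ### The sampling distribution -/

section Sampling

variable {V K : ℕ}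

lemma baseCount_le (hV : 1 ≤ V) (hK : 2 ≤ K) {m : ℕ} {st : State K}
    (hst : ∀ k, (1 / 2 : ℝ) ^ m ≤ st.gap k) (k : Fin K) :
    baseCount V (m + 1) st k ≤ lam V K (m + 1) * 4 ^ m := by
  have hl := lam_pos hV hK (m + 1)
  have h0 : (0 : ℝ) < (1 / 2) ^ m := by positivity
  have hg : 0 < st.gap k := h0.trans_le (hst k)
  have h : (4 : ℝ) ^ m * ((1 / 2 : ℝ) ^ m) ^ 2 = 1 := by
    rw [← pow_mul, mul_comm m 2, pow_mul, ← mul_pow]; norm_num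
  unfold baseCount
  rw [div_le_iff₀ (by positivity), mul_assoc]
  refine le_mul_of_one_le_right hl.le ?_
  rw [← h]
  gcongr
  exact hst k

lemma baseCount_pos (hV : 1 ≤ V) (hK : 2 ≤ K) {m : ℕ} {st : State K}
    (hst : ∀ k, (1 / 2 : ℝ) ^ m ≤ st.gap k) (k : Fin K) : 0 < baseCount V (m + 1) st k := by
  have hl := lam_pos hV hK (m + 1)
  have h0 : (0 : ℝ) < (1 / 2) ^ m := by positivity
  have hg : 0 < st.gap k := h0.trans_le (hst k)
  unfold baseCount
  positivity

variable [NeZero K]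

lemma leader_mem (r : Fin K → ℝ) : leader r ∈ Finset.univ.filter fun k => ∀ j, r j ≤ r k :=
  Finset.min'_mem _ _

lemma le_leader (r : Fin K → ℝ) (j : Fin K) : r j ≤ r (leader r) := by
  have h := leader_mem r
  rw [Finset.mem_filter] at h
  exact h.2 j

lemma leader_eq_iff (r : Fin K → ℝ) (k : Fin K) :
    leader r = k ↔ (∀ j, r j ≤ r k) ∧ ∀ j, (∀ i, r i ≤ r j) → k ≤ j := by
  constructor
  · rintro rfl
    exact ⟨le_leader r, fun j hj => Finset.min'_le _ _ (by simpa using hj)⟩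
  · rintro ⟨h1, h2⟩
    exact le_antisymm (Finset.min'_le _ _ (by simpa using h1)) (h2 _ (le_leader r))

/-- Only the leader needs an argument: the other `K - 1` arms take at most `λ 4^m` each out of at
least `K λ 4^m` rounds, which leaves the leader its own share. -/
lemma baseCount_le_pullCount (hV : 1 ≤ V) (hK : 2 ≤ K) {m : ℕ} {st : State K}
    (hst : ∀ k, (1 / 2 : ℝ) ^ m ≤ st.gap k) (k : Fin K) :
    baseCount V (m + 1) st k ≤ pullCount V (m + 1) st k := by
  unfold pullCount
  split_ifs with h
  · have h1 : ∑ j ∈ Finset.univ.erase (leader st.est), baseCount V (m + 1) st j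
        ≤ ((K : ℝ) - 1) * (lam V K (m + 1) * 4 ^ m) := by
      refine (Finset.sum_le_card_nsmul _ _ _ fun j _ => baseCount_le hV hK hst j).trans ?_
      rw [Finset.card_erase_of_mem (Finset.mem_univ _), Finset.card_univ, Fintype.card_fin,
        nsmul_eq_mul, Nat.cast_sub (by omega), Nat.cast_one]
    have h2 := le_epochLen_succ (V := V) (K := K) m
    have h3 := baseCount_le hV hK hst k
    linarith
  · exact le_rfl

lemma pullCount_pos (hV : 1 ≤ V) (hK : 2 ≤ K) {m : ℕ} {st : State K}
    (hst : ∀ k, (1 / 2 : ℝ) ^ m ≤ st.gap k) (k : Fin K) : 0 < pullCount V (m + 1) st k :=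
  (baseCount_pos hV hK hst k).trans_le (baseCount_le_pullCount hV hK hst k)

lemma sum_pullCount (m : ℕ) (st : State K) :
    ∑ k, pullCount V m st k = epochLen V K m := by
  rw [← Finset.add_sum_erase _ _ (Finset.mem_univ (leader st.est))]
  have : ∑ k ∈ Finset.univ.erase (leader st.est), pullCount V m st k
      = ∑ k ∈ Finset.univ.erase (leader st.est), baseCount V m st k := by
    refine Finset.sum_congr rfl fun k hk => ?_
    rw [pullCount, if_neg (Finset.ne_of_mem_erase hk)]
  rw [this, pullCount, if_pos rfl]
  ring

lemma armProb_nonneg (hV : 1 ≤ V) (hK : 2 ≤ K) {m : ℕ} {st : State K}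
    (hst : ∀ k, (1 / 2 : ℝ) ^ m ≤ st.gap k) (k : Fin K) : 0 ≤ armProb V (m + 1) st k :=
  div_nonneg (pullCount_pos hV hK hst k).le (Nat.cast_nonneg _)

lemma sum_armProb (hV : 1 ≤ V) (hK : 2 ≤ K) (m : ℕ) (st : State K) :
    ∑ k, armProb V (m + 1) st k = 1 := by
  have h := epochLen_succ_pos hV hK m
  have h' : (epochLen V K (m + 1) : ℝ) ≠ 0 := by positivity
  simp only [armProb]
  rw [← Finset.sum_div, sum_pullCount, div_self h']

lemma armProb_le_one (hV : 1 ≤ V) (hK : 2 ≤ K) {m : ℕ} {st : State K}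
    (hst : ∀ k, (1 / 2 : ℝ) ^ m ≤ st.gap k) (k : Fin K) : armProb V (m + 1) st k ≤ 1 := by
  rw [← sum_armProb hV hK m st]
  exact Finset.single_le_sum (fun j _ => armProb_nonneg hV hK hst j) (Finset.mem_univ k)

lemma epochLen_mul_armProb (hV : 1 ≤ V) (hK : 2 ≤ K) (m : ℕ) (st : State K) (k : Fin K) :
    epochLen V K (m + 1) * armProb V (m + 1) st k = pullCount V (m + 1) st k := by
  have h := epochLen_succ_pos hV hK m
  have h' : (epochLen V K (m + 1) : ℝ) ≠ 0 := by positivity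
  unfold armProb
  field_simp

/-- The confidence radius `√(4 ln(4/β_m) / (V ñ_k^m))`. -/
def radius (V : ℕ) {K : ℕ} [NeZero K] (m : ℕ) (st : State K) (k : Fin K) : ℝ :=
  Real.sqrt (4 * logBeta V K m / (V * pullCount V m st k))

lemma radius_nonneg (m : ℕ) (st : State K) (k : Fin K) : 0 ≤ radius V m st k :=
  Real.sqrt_nonneg _

/-- Here `V ñ_k ≥ 256 logTerm / gap²` and `logBeta ≤ 2 logTerm`, so the squared radius is at most
`gap²/32`, and `(9/50)² > 1/32`. This is the contraction rate of all later recursions. -/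
lemma radius_le (hV : 1 ≤ V) (hK : 2 ≤ K) {m : ℕ} {st : State K}
    (hst : ∀ k, (1 / 2 : ℝ) ^ m ≤ st.gap k) (k : Fin K) :
    radius V (m + 1) st k ≤ 9 / 50 * st.gap k := by
  have h0 : (0 : ℝ) < (1 / 2) ^ m := by positivity
  have hg : 0 < st.gap k := h0.trans_le (hst k)
  have hV' : (0 : ℝ) < V := by positivity
  have hp := pullCount_pos hV hK hst k
  refine Real.sqrt_le_iff.mpr ⟨by positivity, ?_⟩
  rw [div_le_iff₀ (by positivity)]
  have h1 := baseCount_le_pullCount hV hK hst k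
  have h2 : (256 * logTerm V K (m + 1)) ≤ st.gap k ^ 2 * (V * pullCount V (m + 1) st k) := by
    rw [← mul_lam_eq hV]
    rw [baseCount, div_le_iff₀ (by positivity)] at h1
    calc V * lam V K (m + 1) ≤ V * (pullCount V (m + 1) st k * st.gap k ^ 2) := by gcongr
      _ = _ := by ring
  have h3 := logBeta_le hV hK (m + 1)
  have h4 := one_le_logTerm hV hK (m + 1)
  rw [mul_pow, mul_assoc]
  linarith

end Sampling

/-! ### The states along a path -/

/-- The discounted sum of the errors `e_1, …, e_m`. -/
def discounted (e : ℕ → ℝ) : ℕ → ℝ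
  | 0 => 0
  | m + 1 => e (m + 1) + 9 / 50 * discounted e m

lemma discounted_nonneg {e : ℕ → ℝ} (he : ∀ m, 0 ≤ e m) (m : ℕ) : 0 ≤ discounted e m := by
  induction m with
  | zero => exact le_rfl
  | succ m ih => have := he (m + 1); simp only [discounted]; positivity

/-- An error made in epoch `s` is felt in epoch `s + 1 + i` with weight at most `5^{i+1} (9/50)^i
N_s = 5 (9/10)^i N_s`, and these weights sum to `50 N_s`. Errors of the last epoch `M` do not enter,
as they affect only later epochs. -/
lemma sum_epochLen_mul_discounted_le {V K : ℕ} (hV : 1 ≤ V) (hK : 2 ≤ K) {e : ℕ → ℝ} (he : ∀ m, 0 ≤ e m)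
    (M : ℕ) : ∑ m ∈ Finset.range M, epochLen V K (m + 1) * discounted e m
      ≤ 50 * ∑ m ∈ Finset.range (M - 1), epochLen V K (m + 1) * e (m + 1) := by
  -- The extra term on the left carries the future cost of the current discounted error: `5 + 50 · 5
  -- · 9/50 = 50` closes the induction.
  have key (n : ℕ) : 50 * (epochLen V K (n + 1) * discounted e (n + 1))
      + ∑ m ∈ Finset.range (n + 1), epochLen V K (m + 1) * discounted e m
      ≤ 50 * ∑ m ∈ Finset.range (n + 1), epochLen V K (m + 1) * e (m + 1) := by
    induction n with
    | zero =>
      simp only [discounted, zero_add, Finset.sum_range_one, mul_zero, add_zero]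
      linarith
    | succ n ih =>
      rw [Finset.sum_range_succ _ (n + 1), Finset.sum_range_succ _ (n + 1)]
      have h1 : (epochLen V K (n + 2) : ℝ) ≤ 5 * epochLen V K (n + 1) := by
        exact_mod_cast epochLen_succ_succ_le hV hK n
      have h2 := mul_le_mul_of_nonneg_right h1 (discounted_nonneg he (n + 1))
      have h3 : discounted e (n + 1 + 1) = e (n + 2) + 9 / 50 * discounted e (n + 1) := rfl
      rw [h3]
      simp only [add_assoc, Nat.reduceAdd] at *
      linarith
  rcases M with _ | _ | n
  · simp
  · simp [discounted]
  · rw [Finset.sum_range_succ]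
    have h1 : (epochLen V K (n + 2) : ℝ) ≤ 5 * epochLen V K (n + 1) := by
      exact_mod_cast epochLen_succ_succ_le hV hK n
    have h2 := mul_le_mul_of_nonneg_right h1 (discounted_nonneg he (n + 1))
    have h3 := key n
    have h4 : 0 ≤ (epochLen V K (n + 1) : ℝ) * discounted e (n + 1) :=
      mul_nonneg (Nat.cast_nonneg _) (discounted_nonneg he _)
    simp only [show n + 1 + 1 - 1 = n + 1 from rfl, add_assoc, Nat.reduceAdd] at *
    linarith

/-- The contribution of the leader to the regret in the epochs that are too short to distinguish
gaps of size `Δ`. -/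
def leaderCost (V K : ℕ) (Δ : ℝ) (m : ℕ) : ℝ :=
  if Δ ≤ 1 / 2 ∧ 2 ^ m * Δ < 9 / 2 then 3 * (K * lam V K (m + 1) * 2 ^ m + (1 / 2) ^ m) else 0

lemma leaderCost_nonneg {V K : ℕ} (hV : 1 ≤ V) (hK : 2 ≤ K) (Δ : ℝ) (m : ℕ) : 0 ≤ leaderCost V K Δ m := by
  have := lam_pos hV hK (m + 1)
  unfold leaderCost
  split_ifs <;> positivity

section Path

variable {V K : ℕ} [NeZero K]

lemma half_pow_le_gap (msg : ℕ → Fin V → Fin K → ℝ) (m : ℕ) (k : Fin K) :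
    (1 / 2 : ℝ) ^ m ≤ (stateAfter msg m).gap k := by
  cases m with
  | zero => simp [stateAfter, State.init]
  | succ m => exact le_max_left _ _

lemma newStar_le {m : ℕ} {st : State K} {msg : Fin V → Fin K → ℝ} {x : ℝ}
    (h : ∀ k, newEst m st msg k ≤ x + radius V m st k) : newStar m st msg ≤ x := by
  refine Finset.sup'_le _ _ fun k _ => ?_
  have := h k
  rw [radius, logBeta] at this
  linarith

lemma le_newStar (m : ℕ) (st : State K) (msg : Fin V → Fin K → ℝ) (k : Fin K) :
    newEst m st msg k - radius V m st k ≤ newStar m st msg :=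
  Finset.le_sup' (fun k : Fin K => newEst m st msg k -
    Real.sqrt (4 * Real.log (4 / beta V K m) / (V * pullCount V m st k))) (Finset.mem_univ k)

lemma est_le_one (msg : ℕ → Fin V → Fin K → ℝ) (m : ℕ) (k : Fin K) :
    (stateAfter msg m).est k ≤ 1 := by
  cases m with
  | zero => simp [stateAfter, State.init]
  | succ m => exact min_le_right _ _

lemma est_nonneg (hV : 1 ≤ V) (hK : 2 ≤ K) {msg : ℕ → Fin V → Fin K → ℝ}
    (hmsg : ∀ m v k, 0 ≤ msg m v k) (m : ℕ) (k : Fin K) : 0 ≤ (stateAfter msg m).est k := by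
  cases m with
  | zero => simp [stateAfter, State.init]
  | succ m =>
    have hp := pullCount_pos hV hK (half_pow_le_gap msg m) k
    refine le_min (div_nonneg (Finset.sum_nonneg fun v _ => hmsg _ _ _) ?_) zero_le_one
    positivity

/-- Truncation at 1 bounds `r_*` and nonnegative messages bound the estimates from below. Besides
the leader estimate for large gaps, this keeps the parameter of the exponential moments in the
admissible range. -/
lemma gap_le_one (hV : 1 ≤ V) (hK : 2 ≤ K) {msg : ℕ → Fin V → Fin K → ℝ}
    (hmsg : ∀ m v k, 0 ≤ msg m v k) (m : ℕ) (k : Fin K) : (stateAfter msg m).gap k ≤ 1 := by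
  cases m with
  | zero => simp [stateAfter, State.init]
  | succ m =>
    refine max_le (pow_le_one₀ (by norm_num) (by norm_num)) ?_
    have h1 : newStar (m + 1) (stateAfter msg m) (msg (m + 1)) ≤ 1 := by
      refine newStar_le fun j => ?_
      have := radius_nonneg (V := V) (m + 1) (stateAfter msg m) j
      have h2 : newEst (m + 1) (stateAfter msg m) (msg (m + 1)) j ≤ 1 := min_le_right _ _
      linarith
    have h2 : 0 ≤ newEst (m + 1) (stateAfter msg m) (msg (m + 1)) k :=
      est_nonneg hV hK hmsg (m + 1) k
    linarith

/-! ### Gap estimates under approximately correct reward estimates -/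

variable {msg : ℕ → Fin V → Fin K → ℝ} {μ : Fin K → ℝ} {e : ℕ → ℝ} {best : Fin K}

/-- Since `r_*` is a maximum of lower confidence bounds, no radius is lost in bounding it by the
best mean; only the radius of `k` itself appears. -/
lemma gap_succ_le (hV : 1 ≤ V) (hK : 2 ≤ K) (hbest : ∀ k, μ k ≤ μ best)
    (herr : ∀ m k, |(stateAfter msg (m + 1)).est k - μ k|
      ≤ e (m + 1) + radius V (m + 1) (stateAfter msg m) k) (m : ℕ) (k : Fin K) :
    (stateAfter msg (m + 1)).gap k ≤ max ((1 / 2) ^ (m + 1))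
      (μ best - μ k + 2 * e (m + 1) + 9 / 50 * (stateAfter msg m).gap k) := by
  refine max_le_max le_rfl ?_
  have h1 : newStar (m + 1) (stateAfter msg m) (msg (m + 1)) ≤ μ best + e (m + 1) := by
    refine newStar_le fun j => ?_
    have h : newEst (m + 1) (stateAfter msg m) (msg (m + 1)) j - μ j ≤ _ := (abs_le.mp (herr m j)).2
    linarith [hbest j]
  have h2 : _ ≤ newEst (m + 1) (stateAfter msg m) (msg (m + 1)) k - μ k := (abs_le.mp (herr m k)).1
  have h3 := radius_le hV hK (half_pow_le_gap msg m) k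
  linarith

/-- The radius of `j` counts twice, once for its estimate and once in the definition of `r_*`; hence
`9/25 = 2 · 9/50`. -/
lemma le_gap_succ (hV : 1 ≤ V) (hK : 2 ≤ K)
    (herr : ∀ m k, |(stateAfter msg (m + 1)).est k - μ k|
      ≤ e (m + 1) + radius V (m + 1) (stateAfter msg m) k) (m : ℕ) (k j : Fin K) :
    μ j - μ k - 2 * e (m + 1) - 9 / 25 * (stateAfter msg m).gap j
      - 9 / 50 * (stateAfter msg m).gap k ≤ (stateAfter msg (m + 1)).gap k := by
  refine le_trans ?_ (le_max_right _ _)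
  have h1 := le_newStar (m + 1) (stateAfter msg m) (msg (m + 1)) j
  have h2 : _ ≤ newEst (m + 1) (stateAfter msg m) (msg (m + 1)) j - μ j := (abs_le.mp (herr m j)).1
  have h3 : newEst (m + 1) (stateAfter msg m) (msg (m + 1)) k - μ k ≤ _ := (abs_le.mp (herr m k)).2
  have h4 := radius_le hV hK (half_pow_le_gap msg m) j
  have h5 := radius_le hV hK (half_pow_le_gap msg m) k
  linarith

lemma gap_le_discounted (hV : 1 ≤ V) (hK : 2 ≤ K) (he : ∀ m, 0 ≤ e m)
    (hbest : ∀ k, μ k ≤ μ best)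
    (herr : ∀ m k, |(stateAfter msg (m + 1)).est k - μ k|
      ≤ e (m + 1) + radius V (m + 1) (stateAfter msg m) k) (m : ℕ) (k : Fin K) :
    (stateAfter msg m).gap k ≤ 2 * (μ best - μ k + (1 / 2) ^ m + discounted e m) := by
  induction m with
  | zero =>
    have := hbest k
    simp only [stateAfter, State.init, discounted, pow_zero]
    linarith
  | succ m ih =>
    have h0 := hbest k
    have h1 := discounted_nonneg he m
    have h2 := he (m + 1)
    have h3 : (0 : ℝ) < (1 / 2) ^ m := by positivity
    refine (gap_succ_le hV hK hbest herr m k).trans (max_le ?_ ?_)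
    · simp only [discounted, pow_succ]; linarith
    · simp only [discounted, pow_succ]; linarith

/-- A gap estimate can be much too small only if past errors are comparable to the true gap. The
scale `2^{-m}` does no harm, since it is itself a lower bound for the estimate. -/
lemma gap_lower_or_discounted (hV : 1 ≤ V) (hK : 2 ≤ K) (he : ∀ m, 0 ≤ e m)
    (hbest : ∀ k, μ k ≤ μ best) (hμ : ∀ k, μ k ∈ Set.Icc (0 : ℝ) 1)
    (herr : ∀ m k, |(stateAfter msg (m + 1)).est k - μ k|
      ≤ e (m + 1) + radius V (m + 1) (stateAfter msg m) k) (m : ℕ) (k : Fin K) :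
    (μ best - μ k) / 10 ≤ (stateAfter msg m).gap k ∨ μ best - μ k ≤ 20 * discounted e m := by
  cases m with
  | zero =>
    left
    have h1 := (hμ best).2
    have h2 := (hμ k).1
    simp only [stateAfter, State.init]
    linarith
  | succ m =>
    have h0 := hbest k
    have h1 := discounted_nonneg he m
    have h2 := he (m + 1)
    have h3 := le_gap_succ hV hK herr m k best
    have h4 := gap_le_discounted hV hK he hbest herr m k
    have h5 := gap_le_discounted hV hK he hbest herr m best
    have h6 := half_pow_le_gap msg (m + 1) k
    simp only [discounted, pow_succ] at *
    -- If both fail, then `2^{-(m+1)} < Δ_k/10` by `h6` and the new discounted error is below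
    -- `Δ_k/20`. Then `h3` with `h4`, `h5` bounds the estimate from below by `(0.64 - 0.216 - 0.3)
    -- Δ_k`, which exceeds `Δ_k/10`.
    by_contra! hcon
    linarith [hcon.1, hcon.2]

/-! ### The leader, and the regret of one epoch along a path -/

lemma leader_gap_le (hV : 1 ≤ V) (hK : 2 ≤ K)
    (herr : ∀ m k, |(stateAfter msg (m + 1)).est k - μ k|
      ≤ e (m + 1) + radius V (m + 1) (stateAfter msg m) k) (m : ℕ) (j : Fin K) :
    μ j - μ (leader (stateAfter msg (m + 1)).est) ≤ 2 * e (m + 1)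
      + 9 / 50 * ((stateAfter msg m).gap (leader (stateAfter msg (m + 1)).est)
        + (stateAfter msg m).gap j) := by
  set l := leader (stateAfter msg (m + 1)).est
  have h1 := (abs_le.mp (herr m j)).1
  have h2 := (abs_le.mp (herr m l)).2
  have h3 : (stateAfter msg (m + 1)).est j ≤ (stateAfter msg (m + 1)).est l := le_leader _ _
  have h4 := radius_le hV hK (half_pow_le_gap msg m) j
  have h5 := radius_le hV hK (half_pow_le_gap msg m) l
  linarith

/-- Inserting `gap_le_discounted` puts `9/25` of the leader's own gap on the right; it is absorbed
on the left, and dividing by `16/25` gives the constants. -/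
lemma leader_gap_le_discounted (hV : 1 ≤ V) (hK : 2 ≤ K) (he : ∀ m, 0 ≤ e m)
    (hbest : ∀ k, μ k ≤ μ best)
    (herr : ∀ m k, |(stateAfter msg (m + 1)).est k - μ k|
      ≤ e (m + 1) + radius V (m + 1) (stateAfter msg m) k) (m : ℕ) :
    μ best - μ (leader (stateAfter msg (m + 1)).est)
      ≤ 9 / 4 * (1 / 2) ^ (m + 1) + 25 / 4 * discounted e (m + 1) := by
  set l := leader (stateAfter msg (m + 1)).est with hl
  have h1 := discounted_nonneg he m
  have h2 := he (m + 1)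
  have h3 := leader_gap_le hV hK herr m best
  have h4 := gap_le_discounted hV hK he hbest herr m l
  have h5 := gap_le_discounted hV hK he hbest herr m best
  rw [← hl] at h3
  simp only [discounted, pow_succ] at *
  linarith

/-- Needed when `Δ > 1/2`: the factor `log(1/Δ)` in the target bound degenerates as `Δ` approaches
1, so no leader cost may be paid there. -/
lemma leader_gap_le_const (hV : 1 ≤ V) (hK : 2 ≤ K) (hmsg : ∀ m v k, 0 ≤ msg m v k)
    (he : ∀ m, 0 ≤ e m)
    (herr : ∀ m k, |(stateAfter msg (m + 1)).est k - μ k|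
      ≤ e (m + 1) + radius V (m + 1) (stateAfter msg m) k) (m : ℕ) (j : Fin K) :
    μ j - μ (leader (stateAfter msg (m + 1)).est) ≤ 9 / 25 + 2 * discounted e (m + 1) := by
  have h1 := discounted_nonneg he m
  have h3 := leader_gap_le hV hK herr m j
  have h4 := gap_le_one hV hK hmsg m (leader (stateAfter msg (m + 1)).est)
  have h5 := gap_le_one hV hK hmsg m j
  simp only [discounted] at *
  linarith

/-- A leader of positive gap has gap at least `Δ`. When the epoch is long enough, or `Δ > 1/2`, the
error-free part of the two preceding bounds is a fixed fraction of that gap, so the gap is at most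
13 times the discounted error. Otherwise the term `9/4 · 2^{-m}`, times the epoch length, is paid as
`leaderCost`. -/
lemma leader_regret_le (hV : 1 ≤ V) (hK : 2 ≤ K) (hmsg : ∀ m v k, 0 ≤ msg m v k)
    (he : ∀ m, 0 ≤ e m) (hbest : ∀ k, μ k ≤ μ best) {Δ : ℝ}
    (hΔ : ∀ k, 0 < μ best - μ k → Δ ≤ μ best - μ k)
    (herr : ∀ m k, |(stateAfter msg (m + 1)).est k - μ k|
      ≤ e (m + 1) + radius V (m + 1) (stateAfter msg m) k) (m : ℕ) :
    (μ best - μ (leader (stateAfter msg (m + 1)).est)) * epochLen V K (m + 2)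
      ≤ 13 * (epochLen V K (m + 2) * discounted e (m + 1)) + leaderCost V K Δ (m + 1) := by
  have h1 := leader_gap_le_discounted hV hK he hbest herr m
  have h2 := leader_gap_le_const hV hK hmsg he herr m best
  set l := leader (stateAfter msg (m + 1)).est with hl
  have hN : (0 : ℝ) ≤ epochLen V K (m + 2) := Nat.cast_nonneg _
  have hρ := discounted_nonneg he (m + 1)
  have hC := leaderCost_nonneg hV hK Δ (m + 1)
  have small (h : μ best - μ l ≤ 13 * discounted e (m + 1)) :
      (μ best - μ l) * epochLen V K (m + 2)
        ≤ 13 * (epochLen V K (m + 2) * discounted e (m + 1)) + leaderCost V K Δ (m + 1) := by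
    have := mul_le_mul_of_nonneg_right h hN
    linarith
  rcases (sub_nonneg.mpr (hbest l)).eq_or_lt with h0 | h0
  · exact small (by rw [← h0]; positivity)
  have hd := hΔ l h0
  by_cases hc : Δ ≤ 1 / 2 ∧ 2 ^ (m + 1) * Δ < 9 / 2
  · rw [leaderCost, if_pos hc]
    have h3 := epochLen_succ_le hV hK (m + 1)
    have h4 : (4 : ℝ) ^ (m + 1) * (1 / 2) ^ (m + 1) = 2 ^ (m + 1) := by
      rw [← mul_pow]; norm_num
    have h5 : (0 : ℝ) < (1 / 2) ^ (m + 1) := by positivity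
    have h6 := mul_le_mul_of_nonneg_right h1 hN
    have h7 := mul_le_mul_of_nonneg_left h3 h5.le
    have h8 := lam_pos hV hK (m + 2)
    have h9 : 0 ≤ (K : ℝ) * lam V K (m + 2) * 2 ^ (m + 1) := by positivity
    have h10 : (1 / 2 : ℝ) ^ (m + 1) * (K * lam V K (m + 2) * 4 ^ (m + 1) + 1)
        = K * lam V K (m + 2) * 2 ^ (m + 1) + (1 / 2) ^ (m + 1) := by
      rw [← h4]; ring
    have h11 := mul_nonneg hN hρ
    rw [show m + 1 + 1 = m + 2 from rfl] at *
    rw [h10] at h7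
    linarith
  · apply small
    rw [not_and_or] at hc
    rcases hc with hc | hc
    -- The leader's gap exceeds `1/2`, so `9/25` is at most `18/25` of it, and `h2` bounds the gap
    -- by `50/7` of the discounted error.
    · linarith
    · have h3 : (1 / 2 : ℝ) ^ (m + 1) * (2 ^ (m + 1) * Δ) = Δ := by
        rw [← mul_assoc, ← mul_pow]; norm_num
      have h4 : (1 / 2 : ℝ) ^ (m + 1) * (9 / 2) ≤ Δ := by
        have := mul_le_mul_of_nonneg_left (not_lt.mp hc)
          (show (0 : ℝ) ≤ (1 / 2) ^ (m + 1) by positivity)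
        linarith
      linarith

lemma baseCount_regret_le (hV : 1 ≤ V) (hK : 2 ≤ K) (he : ∀ m, 0 ≤ e m)
    (hbest : ∀ k, μ k ≤ μ best) (hμ : ∀ k, μ k ∈ Set.Icc (0 : ℝ) 1)
    (herr : ∀ m k, |(stateAfter msg (m + 1)).est k - μ k|
      ≤ e (m + 1) + radius V (m + 1) (stateAfter msg m) k) (m : ℕ) (k : Fin K) :
    (μ best - μ k) * baseCount V (m + 1) (stateAfter msg m) k
      ≤ 100 * lam V K (m + 1) * (μ best - μ k)⁻¹
        + 20 * (lam V K (m + 1) * 4 ^ m * discounted e m) := by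
  have hl := lam_pos hV hK (m + 1)
  have hρ := discounted_nonneg he m
  have hb := baseCount_pos hV hK (half_pow_le_gap msg m) k
  have hb' := baseCount_le hV hK (half_pow_le_gap msg m) k
  rcases (sub_nonneg.mpr (hbest k)).eq_or_lt with h0 | h0
  · rw [← h0]; simp only [zero_mul, inv_zero, mul_zero, zero_add]; positivity
  rcases gap_lower_or_discounted hV hK he hbest hμ herr m k with h | h
  · have h1 : (μ best - μ k) * baseCount V (m + 1) (stateAfter msg m) k
        ≤ (μ best - μ k) * (lam V K (m + 1) / ((μ best - μ k) / 10) ^ 2) := by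
      unfold baseCount
      gcongr
    have h2 : (μ best - μ k) * (lam V K (m + 1) / ((μ best - μ k) / 10) ^ 2)
        = 100 * lam V K (m + 1) * (μ best - μ k)⁻¹ := by
      field_simp; norm_num
    have h3 : 0 ≤ 20 * (lam V K (m + 1) * 4 ^ m * discounted e m) := by positivity
    linarith
  · have h1 : (μ best - μ k) * baseCount V (m + 1) (stateAfter msg m) k
        ≤ (20 * discounted e m) * (lam V K (m + 1) * 4 ^ m) := by gcongr
    have h3 : 0 ≤ 100 * lam V K (m + 1) * (μ best - μ k)⁻¹ := by positivity
    linarith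

/-- The regret of an epoch, in terms of the gaps, the parameters, and the errors so far. -/
lemma epoch_regret_le (hV : 1 ≤ V) (hK : 2 ≤ K) (hmsg : ∀ m v k, 0 ≤ msg m v k)
    (he : ∀ m, 0 ≤ e m) (hbest : ∀ k, μ k ≤ μ best) (hμ : ∀ k, μ k ∈ Set.Icc (0 : ℝ) 1) {Δ : ℝ}
    (hΔ : ∀ k, 0 < μ best - μ k → Δ ≤ μ best - μ k)
    (herr : ∀ m k, |(stateAfter msg (m + 1)).est k - μ k|
      ≤ e (m + 1) + radius V (m + 1) (stateAfter msg m) k) (m : ℕ) :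
    ∑ k, (μ best - μ k) * pullCount V (m + 1) (stateAfter msg m) k
      ≤ 100 * lam V K (m + 1) * (∑ k, (μ best - μ k)⁻¹)
        + 33 * (epochLen V K (m + 1) * discounted e m)
        + leaderCost V K Δ m + (if m = 0 then 1 else 0) := by
  set st := stateAfter msg m with hst
  set l := leader st.est with hl
  have hlam := lam_pos hV hK (m + 1)
  have hρ := discounted_nonneg he m
  have hgap (k : Fin K) : 0 ≤ μ best - μ k := sub_nonneg.mpr (hbest k)
  have hN := le_epochLen_succ (V := V) (K := K) m
  have hbase := baseCount_regret_le hV hK he hbest hμ herr m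
  rw [← hst] at hbase
  have hsum : ∑ k, (μ best - μ k) * baseCount V (m + 1) st k
      ≤ 100 * lam V K (m + 1) * (∑ k, (μ best - μ k)⁻¹)
        + 20 * (epochLen V K (m + 1) * discounted e m) := by
    refine (Finset.sum_le_sum fun k _ => hbase k).trans ?_
    rw [Finset.sum_add_distrib, ← Finset.mul_sum, Finset.sum_const, Finset.card_univ,
      Fintype.card_fin, nsmul_eq_mul]
    have := mul_le_mul_of_nonneg_right hN hρ
    nlinarith
  have hpull : ∑ k, (μ best - μ k) * pullCount V (m + 1) st k
      = ∑ k, (μ best - μ k) * baseCount V (m + 1) st k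
        + (μ best - μ l) * (pullCount V (m + 1) st l - baseCount V (m + 1) st l) := by
    rw [← Finset.add_sum_erase _ _ (Finset.mem_univ l),
      ← Finset.add_sum_erase Finset.univ (fun k => (μ best - μ k) * baseCount V (m + 1) st k)
        (Finset.mem_univ l)]
    have : ∑ k ∈ Finset.univ.erase l, (μ best - μ k) * pullCount V (m + 1) st k
        = ∑ k ∈ Finset.univ.erase l, (μ best - μ k) * baseCount V (m + 1) st k := by
      refine Finset.sum_congr rfl fun k hk => ?_
      rw [pullCount, if_neg (Finset.ne_of_mem_erase hk)]
    rw [this]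
    ring
  have hlead : (μ best - μ l) * (pullCount V (m + 1) st l - baseCount V (m + 1) st l)
      ≤ 13 * (epochLen V K (m + 1) * discounted e m) + leaderCost V K Δ m
        + (if m = 0 then 1 else 0) := by
    have hp : pullCount V (m + 1) st l - baseCount V (m + 1) st l
        = epochLen V K (m + 1) - ∑ j, baseCount V (m + 1) st j := by
      rw [pullCount, if_pos rfl, ← Finset.add_sum_erase Finset.univ _ (Finset.mem_univ l)]
      ring
    cases m with
    | zero =>
      -- The first leader is chosen without data, but all gap estimates are 1, so the shares are
      -- equal and its excess comes only from rounding up `N_1`.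
      have h1 : pullCount V (0 + 1) st l - baseCount V (0 + 1) st l ≤ 1 := by
        have h2 := epochLen_succ_le hV hK 0
        have h3 : ∑ j, baseCount V (0 + 1) st j = K * lam V K (0 + 1) := by
          simp [hst, stateAfter, State.init, baseCount]
        rw [hp, h3]
        linarith
      have h2 : μ best - μ l ≤ 1 := by linarith [(hμ best).2, (hμ l).1]
      have h3 := leaderCost_nonneg hV hK Δ 0
      have h4 : 0 ≤ pullCount V (0 + 1) st l - baseCount V (0 + 1) st l :=
        sub_nonneg.mpr (baseCount_le_pullCount hV hK (half_pow_le_gap msg 0) l)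
      simp only [discounted, if_true, mul_zero, zero_add] at *
      nlinarith [hgap l]
    | succ m =>
      have h1 := leader_regret_le hV hK hmsg he hbest hΔ herr m
      rw [← hst, ← hl] at h1
      have h2 : pullCount V (m + 1 + 1) st l - baseCount V (m + 1 + 1) st l
          ≤ epochLen V K (m + 2) := by
        rw [hp]
        have : 0 ≤ ∑ j, baseCount V (m + 1 + 1) st j :=
          Finset.sum_nonneg fun j _ => (baseCount_pos hV hK (half_pow_le_gap msg (m + 1)) j).le
        linarith
      have h3 := mul_le_mul_of_nonneg_left h2 (hgap l)
      simp only [Nat.add_eq_zero_iff, one_ne_zero, and_false, if_false, add_zero]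
      exact h3.trans h1
  linarith

end Path

end MABarbat

end

noncomputable section

namespace MABarbat

/-! ### Measurability of the states -/

section MeasurableState

variable {V K : ℕ} {Ω : Type*} {_ : MeasurableSpace Ω}

lemma measurable_baseCount {st : Ω → State K} (hg : ∀ k, Measurable fun ω => (st ω).gap k)
    (m : ℕ) (k : Fin K) : Measurable fun ω => baseCount V m (st ω) k := by
  have := hg k
  unfold baseCount
  fun_prop

variable [NeZero K]

lemma measurable_leader {r : Ω → Fin K → ℝ} (hr : ∀ k, Measurable fun ω => r ω k) :
    Measurable fun ω => leader (r ω) := by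
  refine measurable_to_countable' fun k => ?_
  have : (fun ω => leader (r ω)) ⁻¹' {k} =
      {ω | (∀ j, r ω j ≤ r ω k) ∧ ∀ j, (∀ i, r ω i ≤ r ω j) → k ≤ j} := by
    ext ω
    simp [leader_eq_iff]
  rw [this, measurableSet_setOfPred]
  have hle (i j : Fin K) : Measurable fun ω => r ω i ≤ r ω j :=
    measurableSet_setOfPred.mp (measurableSet_le (hr i) (hr j))
  exact (Measurable.forall fun j => hle j k).and
    (Measurable.forall fun j => (Measurable.forall fun i => hle i j).imp measurable_const)

lemma measurable_pullCount {st : Ω → State K} (he : ∀ k, Measurable fun ω => (st ω).est k)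
    (hg : ∀ k, Measurable fun ω => (st ω).gap k) (m : ℕ) (k : Fin K) :
    Measurable fun ω => pullCount V m (st ω) k := by
  have hb := measurable_baseCount (V := V) hg m
  have hl := measurable_leader he
  have hlk (j : Fin K) : MeasurableSet {ω | j = leader (st ω).est} := by
    have : {ω | j = leader (st ω).est} = (fun ω => leader (st ω).est) ⁻¹' {j} := by
      ext ω; simp [eq_comm]
    rw [this]
    exact hl (measurableSet_singleton j)
  unfold pullCount
  refine Measurable.ite (hlk k) (measurable_const.sub ?_) (hb k)
  have : (fun ω => ∑ j ∈ Finset.univ.erase (leader (st ω).est), baseCount V m (st ω) j)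
      = fun ω => ∑ j, if j = leader (st ω).est then 0 else baseCount V m (st ω) j := by
    ext ω
    rw [← Finset.add_sum_erase Finset.univ _ (Finset.mem_univ (leader (st ω).est)), if_pos rfl,
      zero_add]
    exact Finset.sum_congr rfl fun j hj => by rw [if_neg (Finset.ne_of_mem_erase hj)]
  rw [this]
  exact Finset.measurable_sum _ fun j _ => Measurable.ite (hlk j) measurable_const (hb j)

lemma measurable_radius {st : Ω → State K} (he : ∀ k, Measurable fun ω => (st ω).est k)
    (hg : ∀ k, Measurable fun ω => (st ω).gap k) (m : ℕ) (k : Fin K) :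
    Measurable fun ω => radius V m (st ω) k := by
  have := measurable_pullCount (V := V) he hg m k
  unfold radius
  fun_prop

lemma measurable_stateAfter {msg : Ω → ℕ → Fin V → Fin K → ℝ} {m : ℕ}
    (hmsg : ∀ n ≤ m, ∀ v k, Measurable fun ω => msg ω n v k) :
    (∀ k, Measurable fun ω => (stateAfter (msg ω) m).est k) ∧
      ∀ k, Measurable fun ω => (stateAfter (msg ω) m).gap k := by
  induction m with
  | zero => exact ⟨fun k => measurable_const, fun k => measurable_const⟩
  | succ m ih =>
    obtain ⟨he, hg⟩ := ih fun n hn => hmsg n (by omega)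
    have hp := measurable_pullCount (V := V) he hg (m + 1)
    have hE (k : Fin K) : Measurable fun ω =>
        newEst (m + 1) (stateAfter (msg ω) m) (msg ω (m + 1)) k := by
      unfold newEst
      have : Measurable fun ω => ∑ v, msg ω (m + 1) v k :=
        Finset.measurable_sum _ fun v _ => hmsg (m + 1) le_rfl v k
      have := hp k
      fun_prop
    have hS : Measurable fun ω => newStar (m + 1) (stateAfter (msg ω) m) (msg ω (m + 1)) := by
      have h := Finset.measurable_sup' (s := (Finset.univ : Finset (Fin K)))
        Finset.univ_nonempty (f := fun k ω =>
          newEst (m + 1) (stateAfter (msg ω) m) (msg ω (m + 1)) k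
            - radius V (m + 1) (stateAfter (msg ω) m) k)
        (fun k _ => (hE k).sub (measurable_radius he hg (m + 1) k))
      convert h using 1
      ext ω
      rw [Finset.sup'_apply]
      rfl
    exact ⟨hE, fun k => measurable_const.max (hS.sub (hE k))⟩

end MeasurableState

/-! ### Conditional sampling of the arms -/

section Sampling

variable {Ω : Type*} {m mΩ : MeasurableSpace Ω} {P : Measure Ω} [IsProbabilityMeasure P]

/-- On the sub-σ-algebra `m`, the restriction of `P` to `s` has the conditional probability of `s`
as density. The form with lower integrals needs no integrability of `g`. -/
lemma setLIntegral_eq_of_condExp (hm : m ≤ mΩ) {s : Set Ω} (hs : MeasurableSet s) {q : Ω → ℝ}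
    (hq : P⟦s | m⟧ =ᵐ[P] q) {g : Ω → ENNReal} (hg : Measurable[m] g) :
    ∫⁻ ω in s, g ω ∂P = ∫⁻ ω, g ω * ENNReal.ofReal (q ω) ∂P := by
  set f : Ω → ENNReal := fun ω => ENNReal.ofReal ((P⟦s | m⟧) ω) with hf
  have hfm : Measurable f :=
    ((stronglyMeasurable_condExp.mono hm).measurable).ennreal_ofReal
  have hint : Integrable (s.indicator fun _ => (1 : ℝ)) P :=
    (integrable_const 1).indicator hs
  have hnn : 0 ≤ᵐ[P] P⟦s | m⟧ :=
    condExp_nonneg (ae_of_all _ fun ω => Set.indicator_nonneg (fun _ _ => zero_le_one) ω)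
  have key : (P.restrict s).trim hm = (P.withDensity f).trim hm := by
    refine @Measure.ext _ m _ _ fun A hA => ?_
    rw [trim_measurableSet_eq hm hA, trim_measurableSet_eq hm hA,
      Measure.restrict_apply (hm A hA), withDensity_apply _ (hm A hA), hf,
      ← ofReal_integral_eq_lintegral_ofReal integrable_condExp.integrableOn
        (ae_restrict_of_ae hnn), setIntegral_condExp hm hint hA,
      setIntegral_indicator hs, setIntegral_const]
    simp
  calc ∫⁻ ω in s, g ω ∂P = ∫⁻ ω, g ω ∂(P.restrict s).trim hm := (lintegral_trim hm hg).symm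
    _ = ∫⁻ ω, g ω ∂(P.withDensity f) := by rw [key, lintegral_trim hm hg]
    _ = ∫⁻ ω, g ω * f ω ∂P := by
      rw [lintegral_withDensity_eq_lintegral_mul _ hfm (hg.mono hm le_rfl)]
      simp [mul_comm]
    _ = ∫⁻ ω, g ω * ENNReal.ofReal (q ω) ∂P := by
      refine lintegral_congr_ae ?_
      filter_upwards [hq] with ω hω
      simp only [hf]
      rw [hω]

/-- Splitting over the finitely many values of `arm` lets a quantity that is known before the draw,
for each fixed outcome of the draw, be averaged over the sampling law. -/
lemma lintegral_sampled {ι : Type*} [Fintype ι] [MeasurableSpace ι]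
    [MeasurableSingletonClass ι] (hm : m ≤ mΩ) {arm : Ω → ι} (harm : Measurable arm)
    {q : ι → Ω → ℝ} (hq : ∀ a, P⟦{ω | arm ω = a} | m⟧ =ᵐ[P] q a)
    {g : ι → Ω → ENNReal} (hg : ∀ a, Measurable[m] (g a)) :
    ∫⁻ ω, g (arm ω) ω ∂P = ∫⁻ ω, ∑ a, g a ω * ENNReal.ofReal (q a ω) ∂P := by
  classical
  have hs (a : ι) : MeasurableSet {ω | arm ω = a} := harm (measurableSet_singleton a)
  have hgm (a : ι) : Measurable (g a) := (hg a).mono hm le_rfl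
  have h1 : ∫⁻ ω, g (arm ω) ω ∂P = ∫⁻ ω, ∑ a, {ω | arm ω = a}.indicator (g a) ω ∂P := by
    refine lintegral_congr fun ω => ?_
    rw [Finset.sum_eq_single (arm ω)]
    · simp
    · intro a _ ha
      exact Set.indicator_of_notMem (fun h => ha h.symm) _
    · simp
  have h2 : ∫⁻ ω, ∑ a, g a ω * ENNReal.ofReal (q a ω) ∂P
      = ∑ a, ∫⁻ ω, g a ω * ENNReal.ofReal (q a ω) ∂P := by
    refine lintegral_finsetSum' _ fun a _ => (hgm a).aemeasurable.mul ?_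
    have : AEMeasurable (q a) P :=
      ⟨_, (stronglyMeasurable_condExp.mono hm).measurable, (hq a).symm⟩
    exact this.ennreal_ofReal
  rw [h1, h2, lintegral_finsetSum _ fun a _ => (hgm a).indicator (hs a)]
  refine Finset.sum_congr rfl fun a _ => ?_
  rw [lintegral_indicator (hs a), setLIntegral_eq_of_condExp hm (hs a) (hq a) (hg a)]

end Sampling

end MABarbat

end

noncomputable section

namespace MABarbat

/-! ### Exponential moments in one round -/

lemma exp_le_one_add_add_sq {x : ℝ} (hx : |x| ≤ 1) : Real.exp x ≤ 1 + x + x ^ 2 := by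
  have := (abs_le.mp (Real.abs_exp_sub_one_sub_id_le hx)).2
  linarith

section Reward

variable {V K : ℕ} {ν : Measure (Fin K → ℝ)} [IsProbabilityMeasure ν]

lemma integrable_reward (hν : ∀ᵐ x ∂ν, ∀ k, x k ∈ Set.Icc (0 : ℝ) 1) (k : Fin K) :
    Integrable (fun x : Fin K → ℝ => x k) ν := by
  refine Integrable.of_bound (measurable_pi_apply k).aestronglyMeasurable 1 ?_
  filter_upwards [hν] with x hx
  rw [Real.norm_eq_abs, abs_le]
  exact ⟨by linarith [(hx k).1], (hx k).2⟩

lemma mean_mem (hν : ∀ᵐ x ∂ν, ∀ k, x k ∈ Set.Icc (0 : ℝ) 1) (k : Fin K) :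
    mean ν k ∈ Set.Icc (0 : ℝ) 1 := by
  constructor
  · refine integral_nonneg_of_ae ?_
    filter_upwards [hν] with x hx using (hx k).1
  · calc mean ν k ≤ ∫ _, (1 : ℝ) ∂ν := by
          refine integral_mono_ae (integrable_reward hν k) (integrable_const 1) ?_
          filter_upwards [hν] with x hx using (hx k).2
      _ = 1 := by simp

lemma integral_exp_reward_le (hν : ∀ᵐ x ∂ν, ∀ k, x k ∈ Set.Icc (0 : ℝ) 1) (k : Fin K) {s : ℝ}
    (hs : |s| ≤ 1) :
    Integrable (fun x : Fin K → ℝ => Real.exp (s * (x k - mean ν k))) ν ∧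
      ∫ x, Real.exp (s * (x k - mean ν k)) ∂ν ≤ Real.exp (s ^ 2) := by
  have hμ := mean_mem hν k
  have hdev : ∀ᵐ x ∂ν, |x k - mean ν k| ≤ 1 := by
    filter_upwards [hν] with x hx
    rw [abs_le]
    constructor <;> linarith [(hx k).1, (hx k).2, hμ.1, hμ.2]
  have hint : Integrable (fun x : Fin K → ℝ => Real.exp (s * (x k - mean ν k))) ν := by
    have hm : Measurable fun x : Fin K → ℝ => Real.exp (s * (x k - mean ν k)) := by fun_prop
    refine Integrable.of_bound hm.aestronglyMeasurable (Real.exp 1) ?_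
    filter_upwards [hdev] with x hx
    rw [Real.norm_eq_abs, Real.abs_exp]
    refine Real.exp_le_exp.mpr ((le_abs_self _).trans ?_)
    rw [abs_mul]
    nlinarith [abs_nonneg s, abs_nonneg (x k - mean ν k)]
  refine ⟨hint, ?_⟩
  have hr := integrable_reward hν k
  have hd : Integrable (fun x : Fin K → ℝ => s * (x k - mean ν k)) ν :=
    (hr.sub (integrable_const _)).const_mul s
  calc ∫ x, Real.exp (s * (x k - mean ν k)) ∂ν
      ≤ ∫ x : Fin K → ℝ, ((1 + s ^ 2) + s * (x k - mean ν k)) ∂ν := by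
        refine integral_mono_ae hint ((integrable_const _).add hd) ?_
        filter_upwards [hdev] with x hx
        have h1 : |s * (x k - mean ν k)| ≤ 1 := by
          rw [abs_mul]; nlinarith [abs_nonneg s, abs_nonneg (x k - mean ν k)]
        have h2 := exp_le_one_add_add_sq h1
        have h3 : (s * (x k - mean ν k)) ^ 2 ≤ s ^ 2 := by
          rw [mul_pow]
          have : (x k - mean ν k) ^ 2 ≤ 1 := by
            rw [← sq_abs]; exact pow_le_one₀ (abs_nonneg _) hx
          nlinarith [sq_nonneg s]
        linarith
    _ = 1 + s ^ 2 := by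
        rw [integral_add (integrable_const _) hd, integral_const_mul, integral_sub hr (integrable_const _)]
        simp [mean]
    _ ≤ Real.exp (s ^ 2) := by linarith [Real.add_one_le_exp (s ^ 2)]

lemma lintegral_exp_rewards_le (hν : ∀ᵐ x ∂ν, ∀ k, x k ∈ Set.Icc (0 : ℝ) 1) (k : Fin K) {s : ℝ}
    (hs : |s| ≤ 1) :
    ∫⁻ r : Fin V → Fin K → ℝ, ENNReal.ofReal (Real.exp (s * ∑ v, (r v k - mean ν k)))
      ∂(Measure.pi fun _ : Fin V => ν) ≤ ENNReal.ofReal (Real.exp (V * s ^ 2)) := by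
  obtain ⟨hint, hle⟩ := integral_exp_reward_le hν k hs
  have hprod (r : Fin V → Fin K → ℝ) : Real.exp (s * ∑ v, (r v k - mean ν k))
      = ∏ v, Real.exp (s * (r v k - mean ν k)) := by
    rw [Finset.mul_sum, Real.exp_sum]
  have hI : Integrable (fun r : Fin V → Fin K → ℝ => ∏ v, Real.exp (s * (r v k - mean ν k)))
      (Measure.pi fun _ : Fin V => ν) :=
    Integrable.fintype_prod (f := fun (_ : Fin V) (x : Fin K → ℝ) =>
      Real.exp (s * (x k - mean ν k))) fun _ => hint
  simp_rw [hprod]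
  rw [← ofReal_integral_eq_lintegral_ofReal hI
    (ae_of_all _ fun r => Finset.prod_nonneg fun v _ => (Real.exp_pos _).le),
    integral_fintype_prod_eq_pow (fun x : Fin K → ℝ => Real.exp (s * (x k - mean ν k)))]
  refine ENNReal.ofReal_le_ofReal ?_
  rw [Fintype.card_fin, Real.exp_nat_mul]
  exact pow_le_pow_left₀ (integral_nonneg fun x => (Real.exp_pos _).le) hle _

end Reward

/-- The second moment of the centred indicator is `p_k (1 - p_k)`. This sharp value is kept so that
the reward part's `p_k²` fits beside it. The number `c` stands for the corrupted reward and may be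
any value in `[0,1]`. -/
lemma sum_mul_exp_arm_le {K : ℕ} {p : Fin K → ℝ} (hp0 : ∀ j, 0 ≤ p j) (hp1 : ∑ j, p j = 1)
    (k : Fin K) {s c : ℝ} (hs : |s| ≤ 1) (hc : c ∈ Set.Icc (0 : ℝ) 1) :
    ∑ j, p j * Real.exp (s * (((if j = k then 1 else 0) - p k) * c))
      ≤ Real.exp (s ^ 2 * (p k * (1 - p k))) := by
  have hpk : p k ≤ 1 := by
    rw [← hp1]; exact Finset.single_le_sum (fun j _ => hp0 j) (Finset.mem_univ k)
  have hb (j : Fin K) : |(((if j = k then 1 else 0) - p k) * c : ℝ)| ≤ 1 := by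
    rw [abs_mul, abs_of_nonneg hc.1]
    have h1 : |(if j = k then 1 else 0 : ℝ) - p k| ≤ 1 := by
      rw [abs_le]; split_ifs <;> constructor <;> linarith [hp0 k]
    exact mul_le_one₀ h1 hc.1 hc.2
  have h1 (j : Fin K) : p j * Real.exp (s * (((if j = k then 1 else 0) - p k) * c))
      ≤ p j * (1 + s * (((if j = k then 1 else 0) - p k) * c)
        + (s * (((if j = k then 1 else 0) - p k) * c)) ^ 2) := by
    refine mul_le_mul_of_nonneg_left (exp_le_one_add_add_sq ?_) (hp0 j)
    rw [abs_mul]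
    exact mul_le_one₀ hs (abs_nonneg _) (hb j)
  have h2 (j : Fin K) : p j * (1 + s * (((if j = k then 1 else 0) - p k) * c)
        + (s * (((if j = k then 1 else 0) - p k) * c)) ^ 2)
      = p j * (1 - s * p k * c + s ^ 2 * p k ^ 2 * c ^ 2)
        + if j = k then p j * (s * c + s ^ 2 * c ^ 2 * (1 - 2 * p k)) else 0 := by
    split_ifs <;> ring
  calc _ ≤ _ := Finset.sum_le_sum fun j _ => h1 j
    _ = 1 + s ^ 2 * (p k * (1 - p k)) * c ^ 2 := by
      simp_rw [h2]
      rw [Finset.sum_add_distrib, ← Finset.sum_mul, hp1, Finset.sum_ite_eq' Finset.univ k,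
        if_pos (Finset.mem_univ k)]
      ring
    _ ≤ 1 + s ^ 2 * (p k * (1 - p k)) := by
      have h3 : 0 ≤ s ^ 2 * (p k * (1 - p k)) :=
        mul_nonneg (sq_nonneg s) (mul_nonneg (hp0 k) (by linarith))
      have h4 : c ^ 2 ≤ 1 := pow_le_one₀ hc.1 hc.2
      nlinarith
    _ ≤ _ := by linarith [Real.add_one_le_exp (s ^ 2 * (p k * (1 - p k)))]

namespace Play

variable {V K : ℕ} {ν : Measure (Fin K → ℝ)} {Ω : Type*} [mΩ : MeasurableSpace Ω]
  {P : Measure Ω}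

/-- The centred contribution of round `t` to the estimate of arm `k`, if arms are drawn
from `p`. -/
def deviation (B : Play V K ν P) (p : Ω → Fin K → ℝ) (t : ℕ) (k : Fin K) (ω : Ω) : ℝ :=
  ∑ v, (((if B.arm t ω v = k then 1 else 0) - p ω k) * B.corrupted t ω v k
    + p ω k * (B.reward t ω v k - mean ν k))

lemma mid_le (B : Play V K ν P) (t : ℕ) : B.mid t ≤ mΩ := (B.mid_le_past t).trans (B.past_le _)

lemma measurable_reward_mid (B : Play V K ν P) (t : ℕ) (v : Fin V) (k : Fin K) :
    Measurable[B.mid t] fun ω => B.reward t ω v k :=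
  (measurable_pi_apply k).comp ((measurable_pi_apply v).comp (B.measurable_reward t))

lemma measurable_corrupted_mid (B : Play V K ν P) (t : ℕ) (v : Fin V) (k : Fin K) :
    Measurable[B.mid t] fun ω => B.corrupted t ω v k :=
  (measurable_pi_apply k).comp ((measurable_pi_apply v).comp (B.measurable_corrupted t))

variable [IsProbabilityMeasure ν] [IsProbabilityMeasure P]

/-- The pair `(Z, s)` is determined by the past, hence independent of the round's rewards; for a
fixed value of the pair, the integral over the product law is `lintegral_exp_rewards_le`. -/
lemma lintegral_exp_reward_mul_le (B : Play V K ν P)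
    (hν : ∀ᵐ x ∂ν, ∀ k, x k ∈ Set.Icc (0 : ℝ) 1) (t : ℕ) (k : Fin K)
    {s : Ω → ℝ} (hsm : Measurable[B.past t] s) (hs : ∀ᵐ ω ∂P, |s ω| ≤ 1)
    {Z : Ω → ENNReal} (hZ : Measurable[B.past t] Z) :
    ∫⁻ ω, Z ω * ENNReal.ofReal (Real.exp (-(V * s ω ^ 2)))
      * ENNReal.ofReal (Real.exp (s ω * ∑ v, (B.reward t ω v k - mean ν k))) ∂P
      ≤ ∫⁻ ω, Z ω ∂P := by
  have hR : Measurable (B.reward t) := (B.measurable_reward t).mono (B.mid_le t) le_rfl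
  set Y : Ω → ENNReal × ℝ := fun ω => (Z ω, s ω) with hY
  have hYp : Measurable[B.past t] Y := hZ.prodMk hsm
  have hYm : Measurable Y := hYp.mono (B.past_le t) le_rfl
  have hind : IndepFun Y (B.reward t) P := by
    rw [IndepFun_iff_Indep]
    exact indep_of_indep_of_le_left (B.indep_reward t) hYp.comap_le
  have hmap := (indepFun_iff_map_prod_eq_prod_map_map hYm.aemeasurable hR.aemeasurable).mp hind
  set F : (ENNReal × ℝ) × (Fin V → Fin K → ℝ) → ENNReal := fun x =>
    x.1.1 * ENNReal.ofReal (Real.exp (-(V * x.1.2 ^ 2)))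
      * ENNReal.ofReal (Real.exp (x.1.2 * ∑ v, (x.2 v k - mean ν k))) with hF
  have hFm : Measurable F := by fun_prop
  have h1 : ∫⁻ ω, F (Y ω, B.reward t ω) ∂P
      = ∫⁻ y, ∫⁻ r, F (y, r) ∂(Measure.pi fun _ : Fin V => ν) ∂(P.map Y) := by
    rw [← lintegral_map hFm (hYm.prodMk hR), hmap, lintegral_prod _ hFm.aemeasurable,
      B.law_reward t]
  have hsY : ∀ᵐ y ∂(P.map Y), |y.2| ≤ 1 := by
    rw [ae_map_iff hYm.aemeasurable (measurableSet_le (by fun_prop) measurable_const)]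
    exact hs
  calc _ = ∫⁻ ω, F (Y ω, B.reward t ω) ∂P := rfl
    _ = ∫⁻ y, ∫⁻ r, F (y, r) ∂(Measure.pi fun _ : Fin V => ν) ∂(P.map Y) := h1
    _ ≤ ∫⁻ y, y.1 ∂(P.map Y) := by
      refine lintegral_mono_ae ?_
      filter_upwards [hsY] with y hy
      simp only [hF]
      rw [lintegral_const_mul _ (by fun_prop)]
      calc _ ≤ y.1 * ENNReal.ofReal (Real.exp (-(V * y.2 ^ 2)))
            * ENNReal.ofReal (Real.exp (V * y.2 ^ 2)) := by
            gcongr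
            exact lintegral_exp_rewards_le hν k hy
        _ = y.1 := by
            rw [mul_assoc, ← ENNReal.ofReal_mul (Real.exp_pos _).le, ← Real.exp_add]
            simp
    _ = ∫⁻ ω, Z ω ∂P := lintegral_map measurable_fst hYm

/-- One supermartingale step. Corrupted rewards depend on the true ones, so the two sources of noise
are removed in order: given `mid t`, averaging over the arms disposes of the corrupted values; what
is left involves only the true rewards, independent of the past. -/
lemma lintegral_exp_deviation_le (B : Play V K ν P)
    (hν : ∀ᵐ x ∂ν, ∀ k, x k ∈ Set.Icc (0 : ℝ) 1) (t : ℕ) (k : Fin K)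
    {p : Ω → Fin K → ℝ} (hpm : ∀ j, Measurable[B.past t] fun ω => p ω j)
    (hp0 : ∀ ω j, 0 ≤ p ω j) (hp1 : ∀ ω, ∑ j, p ω j = 1)
    (harm : ∀ a : Fin V → Fin K,
      P⟦{ω | B.arm t ω = a} | B.mid t⟧ =ᵐ[P] fun ω => ∏ v, p ω (a v))
    {h : Ω → ℝ} (hhm : Measurable[B.past t] h) (hh : ∀ᵐ ω ∂P, |h ω| ≤ 1)
    {Z : Ω → ENNReal} (hZ : Measurable[B.past t] Z) :
    ∫⁻ ω, Z ω * ENNReal.ofReal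
        (Real.exp (h ω * B.deviation p t k ω - h ω ^ 2 * (V * p ω k))) ∂P
      ≤ ∫⁻ ω, Z ω ∂P := by
  have hpmid (j : Fin K) : Measurable[B.mid t] fun ω => p ω j :=
    (hpm j).mono (B.past_le_mid t) le_rfl
  have hhmid : Measurable[B.mid t] h := hhm.mono (B.past_le_mid t) le_rfl
  have hZmid : Measurable[B.mid t] Z := hZ.mono (B.past_le_mid t) le_rfl
  have harmm : Measurable (B.arm t) := (B.measurable_arm t).mono (B.past_le _) le_rfl
  have hRm := B.measurable_reward_mid t
  have hCm := B.measurable_corrupted_mid t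
  have hpk1 (ω : Ω) : p ω k ≤ 1 := by
    rw [← hp1 ω]; exact Finset.single_le_sum (fun j _ => hp0 ω j) (Finset.mem_univ k)
  set W : Ω → ENNReal := fun ω => Z ω * ENNReal.ofReal (Real.exp
    (h ω * (p ω k * ∑ v, (B.reward t ω v k - mean ν k)) - h ω ^ 2 * (V * p ω k))) with hW
  have hWm : Measurable[B.mid t] W := by
    have h1 : Measurable[B.mid t] fun ω => ∑ v, (B.reward t ω v k - mean ν k) :=
      Finset.measurable_sum _ fun v _ => (hRm v k).sub_const _
    exact hZmid.mul (((hhmid.mul ((hpmid k).mul h1)).sub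
      ((hhmid.pow_const 2).mul ((hpmid k).const_mul _))).exp.ennreal_ofReal)
  set A : (Fin V → Fin K) → Ω → ℝ := fun a ω =>
    ∏ v, Real.exp (h ω * (((if a v = k then 1 else 0) - p ω k) * B.corrupted t ω v k)) with hA
  have hAm (a : Fin V → Fin K) : Measurable[B.mid t] (A a) :=
    Finset.measurable_prod _ fun v _ =>
      (hhmid.mul ((measurable_const.sub (hpmid k)).mul (hCm v k))).exp
  have hA0 (a : Fin V → Fin K) (ω : Ω) : 0 ≤ A a ω :=
    Finset.prod_nonneg fun v _ => (Real.exp_pos _).le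
  have hsplit (ω : Ω) : Z ω * ENNReal.ofReal
      (Real.exp (h ω * B.deviation p t k ω - h ω ^ 2 * (V * p ω k)))
      = W ω * ENNReal.ofReal (A (B.arm t ω) ω) := by
    simp only [hW, hA]
    rw [mul_assoc, ← ENNReal.ofReal_mul (Real.exp_pos _).le, ← Real.exp_sum, ← Real.exp_add]
    congr 3
    rw [deviation, Finset.sum_add_distrib, ← Finset.mul_sum, ← Finset.mul_sum]
    ring
  have hsum (ω : Ω) (hω : |h ω| ≤ 1) (hc : ∀ v k, B.corrupted t ω v k ∈ Set.Icc (0 : ℝ) 1) :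
      ∑ a, A a ω * ∏ v, p ω (a v) ≤ Real.exp (V * (h ω ^ 2 * (p ω k * (1 - p ω k)))) := by
    have h1 : ∑ a : Fin V → Fin K, A a ω * ∏ v, p ω (a v) = ∏ v, ∑ j, p ω j *
        Real.exp (h ω * (((if j = k then 1 else 0) - p ω k) * B.corrupted t ω v k)) := by
      rw [Finset.prod_univ_sum, Fintype.piFinset_univ]
      refine Finset.sum_congr rfl fun a _ => ?_
      simp only [hA]
      rw [Finset.prod_mul_distrib, mul_comm]
    rw [h1, Real.exp_nat_mul]
    refine (Finset.prod_le_prod (fun v _ => Finset.sum_nonneg fun j _ =>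
      mul_nonneg (hp0 ω j) (Real.exp_pos _).le) fun v _ =>
      sum_mul_exp_arm_le (hp0 ω) (hp1 ω) k hω (hc v k)).trans ?_
    simp
  simp_rw [hsplit]
  rw [lintegral_sampled (B.mid_le t) harmm harm
    (g := fun a ω => W ω * ENNReal.ofReal (A a ω))
    (fun a => hWm.mul (hAm a).ennreal_ofReal)]
  have hs1 : ∀ᵐ ω ∂P, |h ω * p ω k| ≤ 1 := by
    filter_upwards [hh] with ω hω
    rw [abs_mul, abs_of_nonneg (hp0 ω k)]
    exact mul_le_one₀ hω (hp0 ω k) (hpk1 ω)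
  refine le_trans ?_ (B.lintegral_exp_reward_mul_le hν t k (hhm.mul (hpm k)) hs1 hZ)
  refine lintegral_mono_ae ?_
  filter_upwards [hh, B.corrupted_mem t] with ω hω hc
  calc ∑ a : Fin V → Fin K, W ω * ENNReal.ofReal (A a ω) * ENNReal.ofReal (∏ v, p ω (a v))
      = W ω * ENNReal.ofReal (∑ a : Fin V → Fin K, A a ω * ∏ v, p ω (a v)) := by
        rw [ENNReal.ofReal_sum_of_nonneg fun a _ =>
          mul_nonneg (hA0 a ω) (Finset.prod_nonneg fun v _ => hp0 ω _), Finset.mul_sum]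
        refine Finset.sum_congr rfl fun a _ => ?_
        rw [ENNReal.ofReal_mul (hA0 a ω), mul_assoc]
    _ ≤ W ω * ENNReal.ofReal (Real.exp (V * (h ω ^ 2 * (p ω k * (1 - p ω k))))) := by
        gcongr
        exact hsum ω hω hc
    -- The arms contribute `V h² p_k (1 - p_k)`, and rewards with parameter `h p_k` need `V h²
    -- p_k²`; together they use up exactly `h² V p_k`.
    _ = _ := by
        simp only [hW, Pi.mul_apply]
        rw [mul_assoc, mul_assoc, ← ENNReal.ofReal_mul (Real.exp_pos _).le,
          ← ENNReal.ofReal_mul (Real.exp_pos _).le, ← Real.exp_add, ← Real.exp_add]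
        congr 3
        ring

end Play

end MABarbat

end

noncomputable section

namespace MABarbat

/-! ### Concentration in one epoch -/

namespace Play

variable {V K : ℕ} {ν : Measure (Fin K → ℝ)} {Ω : Type*} [mΩ : MeasurableSpace Ω]
  {P : Measure Ω}

lemma past_mono (B : Play V K ν P) : Monotone B.past :=
  monotone_nat_of_le_succ fun t => (B.past_le_mid t).trans (B.mid_le_past t)

lemma measurableSet_arm_eq (B : Play V K ν P) (t : ℕ) (v : Fin V) (k : Fin K) :
    MeasurableSet[B.past (t + 1)] {ω | B.arm t ω v = k} :=
  ((measurable_pi_apply v).comp (B.measurable_arm t)) (measurableSet_singleton k)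

lemma measurable_messages (B : Play V K ν P) (hV : 1 ≤ V) (hK : 2 ≤ K) {n m : ℕ} (hn : n ≤ m)
    (v : Fin V) (k : Fin K) :
    Measurable[B.past (endTime V K m)] fun ω => B.messages ω n v k := by
  unfold messages message
  refine Finset.measurable_sum _ fun t ht => ?_
  have ht' : t + 1 ≤ endTime V K m :=
    (Finset.mem_Ico.mp ht).2.trans_le ((endTime_strictMono hV hK).monotone hn)
  refine Measurable.mono ?_ (B.past_mono ht') le_rfl
  have h : (fun ω => if B.arm t ω v = k then B.corrupted t ω v (B.arm t ω v) else 0)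
      = fun ω => if B.arm t ω v = k then B.corrupted t ω v k else 0 := by
    ext ω
    split_ifs with h
    · rw [h]
    · rfl
  rw [h]
  exact Measurable.ite (B.measurableSet_arm_eq t v k)
    ((B.measurable_corrupted_mid t v k).mono (B.mid_le_past t) le_rfl) measurable_const

lemma measurable_deviation (B : Play V K ν P) {p : Ω → Fin K → ℝ} {t : ℕ}
    (hp : ∀ j, Measurable[B.past t] fun ω => p ω j) (k : Fin K) :
    Measurable[B.past (t + 1)] (B.deviation p t k) := by
  unfold deviation
  have hle : B.past t ≤ B.past (t + 1) := B.past_mono (Nat.le_succ t)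
  refine Finset.measurable_sum _ fun v _ => Measurable.add (Measurable.mul (Measurable.sub
    (Measurable.ite (B.measurableSet_arm_eq t v k) measurable_const measurable_const)
    ((hp k).mono hle le_rfl)) ((B.measurable_corrupted_mid t v k).mono (B.mid_le_past t) le_rfl))
    (Measurable.mul ((hp k).mono hle le_rfl) (Measurable.sub_const
      ((B.measurable_reward_mid t v k).mono (B.mid_le_past t) le_rfl) _))

lemma ae_reward_mem [IsProbabilityMeasure ν] (B : Play V K ν P)
    (hν : ∀ᵐ x ∂ν, ∀ k, x k ∈ Set.Icc (0 : ℝ) 1) :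
    ∀ᵐ ω ∂P, ∀ t v k, B.reward t ω v k ∈ Set.Icc (0 : ℝ) 1 := by
  refine ae_all_iff.mpr fun t => ?_
  have h : ∀ᵐ r ∂(Measure.pi fun _ : Fin V => ν), ∀ v k, r v k ∈ Set.Icc (0 : ℝ) 1 :=
    ae_all_iff.mpr fun v =>
      (Measure.tendsto_eval_ae_ae (μ := fun _ : Fin V => ν) (i := v)).eventually hν
  rw [← B.law_reward t] at h
  exact ae_of_ae_map ((B.measurable_reward t).mono (B.mid_le t) le_rfl).aemeasurable h

lemma ae_corrupted_mem (B : Play V K ν P) :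
    ∀ᵐ ω ∂P, ∀ t v k, B.corrupted t ω v k ∈ Set.Icc (0 : ℝ) 1 :=
  ae_all_iff.mpr B.corrupted_mem

lemma messages_nonneg (B : Play V K ν P) {ω : Ω}
    (h : ∀ t v k, B.corrupted t ω v k ∈ Set.Icc (0 : ℝ) 1) (m : ℕ) (v : Fin V) (k : Fin K) :
    0 ≤ B.messages ω m v k := by
  unfold messages message
  refine Finset.sum_nonneg fun t _ => ?_
  split_ifs
  · exact (h _ _ _).1
  · exact le_rfl

variable [NeZero K]

/-- The state after epoch `m`. -/
def state (B : Play V K ν P) (m : ℕ) (ω : Ω) : State K := stateAfter (B.messages ω) m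

/-- The sampling distribution of epoch `m + 1`. -/
def prob (B : Play V K ν P) (m : ℕ) (ω : Ω) (k : Fin K) : ℝ := armProb V (m + 1) (B.state m ω) k

lemma half_pow_le_state_gap (B : Play V K ν P) (m : ℕ) (ω : Ω) (k : Fin K) :
    (1 / 2 : ℝ) ^ m ≤ (B.state m ω).gap k := half_pow_le_gap _ m k

lemma measurable_state (B : Play V K ν P) (hV : 1 ≤ V) (hK : 2 ≤ K) (m : ℕ) :
    (∀ k, Measurable[B.past (endTime V K m)] fun ω => (B.state m ω).est k) ∧
      ∀ k, Measurable[B.past (endTime V K m)] fun ω => (B.state m ω).gap k :=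
  measurable_stateAfter fun _ hn v k => B.measurable_messages hV hK hn v k

lemma measurable_state_pullCount (B : Play V K ν P) (hV : 1 ≤ V) (hK : 2 ≤ K) (m : ℕ)
    (k : Fin K) :
    Measurable[B.past (endTime V K m)] fun ω => pullCount V (m + 1) (B.state m ω) k :=
  measurable_pullCount (B.measurable_state hV hK m).1 (B.measurable_state hV hK m).2 _ k

lemma measurable_prob (B : Play V K ν P) (hV : 1 ≤ V) (hK : 2 ≤ K) (m : ℕ) (k : Fin K) :
    Measurable[B.past (endTime V K m)] fun ω => B.prob m ω k :=
  (B.measurable_state_pullCount hV hK m k).div_const _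

lemma measurable_state_radius (B : Play V K ν P) (hV : 1 ≤ V) (hK : 2 ≤ K) (m : ℕ)
    (k : Fin K) :
    Measurable[B.past (endTime V K m)] fun ω => radius V (m + 1) (B.state m ω) k :=
  measurable_radius (B.measurable_state hV hK m).1 (B.measurable_state hV hK m).2 _ k

lemma prob_nonneg (B : Play V K ν P) (hV : 1 ≤ V) (hK : 2 ≤ K) (m : ℕ) (ω : Ω) (k : Fin K) :
    0 ≤ B.prob m ω k := armProb_nonneg hV hK (B.half_pow_le_state_gap m ω) k

lemma prob_le_one (B : Play V K ν P) (hV : 1 ≤ V) (hK : 2 ≤ K) (m : ℕ) (ω : Ω) (k : Fin K) :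
    B.prob m ω k ≤ 1 := armProb_le_one hV hK (B.half_pow_le_state_gap m ω) k

lemma sum_prob (B : Play V K ν P) (hV : 1 ≤ V) (hK : 2 ≤ K) (m : ℕ) (ω : Ω) :
    ∑ k, B.prob m ω k = 1 := sum_armProb hV hK m _

/-- The event that the estimate of arm `k` in epoch `m + 1` deviates too much. -/
def badArm (B : Play V K ν P) (m : ℕ) (k : Fin K) : Set Ω :=
  {ω | V * pullCount V (m + 1) (B.state m ω) k * radius V (m + 1) (B.state m ω) k
    < |∑ t ∈ Finset.Ico (endTime V K m) (endTime V K (m + 1)), B.deviation (B.prob m) t k ω|}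

/-- The event that some estimate in epoch `m + 1` deviates too much. -/
def badEvent (B : Play V K ν P) (m : ℕ) : Set Ω := ⋃ k, B.badArm m k

lemma measurable_sum_deviation (B : Play V K ν P) (hV : 1 ≤ V) (hK : 2 ≤ K) (m n : ℕ)
    (k : Fin K) : Measurable[B.past (endTime V K m + n)] fun ω =>
      ∑ t ∈ Finset.Ico (endTime V K m) (endTime V K m + n), B.deviation (B.prob m) t k ω := by
  refine Finset.measurable_sum _ fun t ht => ?_
  rw [Finset.mem_Ico] at ht
  exact (B.measurable_deviation (fun j => (B.measurable_prob hV hK m j).mono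
    (B.past_mono ht.1) le_rfl) k).mono (B.past_mono (by omega)) le_rfl

lemma measurableSet_badEvent (B : Play V K ν P) (hV : 1 ≤ V) (hK : 2 ≤ K) (m : ℕ) :
    MeasurableSet (B.badEvent m) := by
  refine MeasurableSet.iUnion fun k => measurableSet_lt ?_ ?_
  · exact (((B.measurable_state_pullCount hV hK m k).const_mul _).mul
      (B.measurable_state_radius hV hK m k)).mono (B.past_le _) le_rfl
  · exact ((B.measurable_sum_deviation hV hK m (epochLen V K (m + 1)) k).mono
      (B.past_le _) le_rfl).norm

variable [IsProbabilityMeasure ν] [IsProbabilityMeasure P]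

lemma lintegral_exp_sum_deviation_le (B : Play V K ν P) (hB : B.FollowsMABarbat) (hV : 1 ≤ V)
    (hK : 2 ≤ K) (hν : ∀ᵐ x ∂ν, ∀ k, x k ∈ Set.Icc (0 : ℝ) 1) (m : ℕ) (k : Fin K)
    {h : Ω → ℝ} (hhm : Measurable[B.past (endTime V K m)] h) (hh : ∀ᵐ ω ∂P, |h ω| ≤ 1)
    {n : ℕ} (hn : n ≤ epochLen V K (m + 1)) :
    ∫⁻ ω, ENNReal.ofReal (Real.exp
        (h ω * ∑ t ∈ Finset.Ico (endTime V K m) (endTime V K m + n), B.deviation (B.prob m) t k ω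
          - n * (h ω ^ 2 * (V * B.prob m ω k)))) ∂P ≤ 1 := by
  induction n with
  | zero => simp
  | succ n ih =>
    refine le_trans ?_ (ih (by omega))
    have hle : B.past (endTime V K m) ≤ B.past (endTime V K m + n) := B.past_mono (by omega)
    have hZ : Measurable[B.past (endTime V K m + n)] fun ω => ENNReal.ofReal (Real.exp
        (h ω * ∑ t ∈ Finset.Ico (endTime V K m) (endTime V K m + n), B.deviation (B.prob m) t k ω
          - n * (h ω ^ 2 * (V * B.prob m ω k)))) := by
      have h1 := B.measurable_sum_deviation hV hK m n k
      have h2 := (B.measurable_prob hV hK m k).mono hle le_rfl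
      have h3 := hhm.mono hle le_rfl
      exact ((h3.mul h1).sub (((h3.pow_const 2).mul (h2.const_mul _)).const_mul _)).exp.ennreal_ofReal
    refine le_trans (le_of_eq ?_) (B.lintegral_exp_deviation_le hν (endTime V K m + n) k
      (p := B.prob m) (fun j => (B.measurable_prob hV hK m j).mono hle le_rfl)
      (B.prob_nonneg hV hK m) (B.sum_prob hV hK m)
      (hB m _ (by omega) (by simp only [endTime]; omega)) (hhm.mono hle le_rfl) hh hZ)
    refine lintegral_congr fun ω => ?_
    rw [← ENNReal.ofReal_mul (Real.exp_pos _).le, ← Real.exp_add, ← add_assoc,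
      Finset.sum_Ico_succ_top (by omega)]
    congr 2
    push_cast
    ring

/-- Although the radius `r` and the count `ñ` are random, `r² V ñ = 4 logBeta` is constant. With `h
= ± r/2` the exponent on the event is at least `r² V ñ/2 - r² V ñ/4 = logBeta`, so Markov's
inequality gives `β/4` on each side. -/
lemma measure_badArm_le (B : Play V K ν P) (hB : B.FollowsMABarbat) (hV : 1 ≤ V)
    (hK : 2 ≤ K) (hν : ∀ᵐ x ∂ν, ∀ k, x k ∈ Set.Icc (0 : ℝ) 1) (m : ℕ) (k : Fin K) :
    P (B.badArm m k) ≤ ENNReal.ofReal (beta V K (m + 1) / 2) := by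
  have hL := logBeta_pos hV hK (m + 1)
  have hV' : (0 : ℝ) < V := by positivity
  set r : Ω → ℝ := fun ω => radius V (m + 1) (B.state m ω) k with hr
  set S : Ω → ℝ := fun ω => ∑ t ∈ Finset.Ico (endTime V K m) (endTime V K (m + 1)),
    B.deviation (B.prob m) t k ω with hS
  have hr0 (ω : Ω) : 0 ≤ r ω := radius_nonneg _ _ _
  have hrm : Measurable[B.past (endTime V K m)] r := B.measurable_state_radius hV hK m k
  have hsq (ω : Ω) : r ω ^ 2 * (V * pullCount V (m + 1) (B.state m ω) k)
      = 4 * logBeta V K (m + 1) := by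
    have hp := pullCount_pos hV hK (B.half_pow_le_state_gap m ω) k
    simp only [hr, radius]
    rw [Real.sq_sqrt (by positivity)]
    field_simp
  have hr1 : ∀ᵐ ω ∂P, r ω ≤ 1 := by
    filter_upwards [B.ae_corrupted_mem] with ω hω
    have h1 := radius_le hV hK (B.half_pow_le_state_gap m ω) k
    have h2 : (B.state m ω).gap k ≤ 1 := gap_le_one hV hK (B.messages_nonneg hω) m k
    simp only [hr]
    linarith
  have tail (σ : ℝ) (hσ : |σ| = 1) :
      P {ω | V * pullCount V (m + 1) (B.state m ω) k * r ω ≤ σ * S ω}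
        ≤ ENNReal.ofReal (beta V K (m + 1) / 4) := by
    have hσ2 : σ ^ 2 = 1 := by rw [← sq_abs, hσ, one_pow]
    have hh : ∀ᵐ ω ∂P, |σ / 2 * r ω| ≤ 1 := by
      filter_upwards [hr1] with ω hω
      rw [abs_mul, abs_div, hσ, abs_of_nonneg (hr0 ω)]
      norm_num
      linarith
    have h1 := B.lintegral_exp_sum_deviation_le hB hV hK hν m k (hrm.const_mul (σ / 2)) hh
      (le_refl (epochLen V K (m + 1)))
    rw [show endTime V K m + epochLen V K (m + 1) = endTime V K (m + 1) from rfl] at h1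
    have hm : Measurable fun ω => ENNReal.ofReal (Real.exp (σ / 2 * r ω * S ω
        - (epochLen V K (m + 1)) * ((σ / 2 * r ω) ^ 2 * (V * B.prob m ω k)))) := by
      have h2 : Measurable r := hrm.mono (B.past_le _) le_rfl
      have h3 : Measurable S :=
        (B.measurable_sum_deviation hV hK m (epochLen V K (m + 1)) k).mono (B.past_le _) le_rfl
      have h4 : Measurable fun ω => B.prob m ω k :=
        (B.measurable_prob hV hK m k).mono (B.past_le _) le_rfl
      fun_prop
    have hpos : 0 < Real.exp (logBeta V K (m + 1)) := Real.exp_pos _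
    calc P {ω | V * pullCount V (m + 1) (B.state m ω) k * r ω ≤ σ * S ω}
        ≤ P {ω | ENNReal.ofReal (Real.exp (logBeta V K (m + 1))) ≤
            ENNReal.ofReal (Real.exp (σ / 2 * r ω * S ω
              - (epochLen V K (m + 1)) * ((σ / 2 * r ω) ^ 2 * (V * B.prob m ω k))))} := by
          refine measure_mono fun ω hω => ?_
          simp only [Set.mem_ofPred_eq] at hω ⊢
          refine ENNReal.ofReal_le_ofReal (Real.exp_le_exp.mpr ?_)
          have h2 := epochLen_mul_armProb hV hK m (B.state m ω) k
          have h3 : (epochLen V K (m + 1)) * ((σ / 2 * r ω) ^ 2 * (V * B.prob m ω k))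
              = logBeta V K (m + 1) := by
            calc _ = σ ^ 2 / 4 * (r ω ^ 2 * (V * (epochLen V K (m + 1) * B.prob m ω k))) := by ring
              _ = _ := by rw [prob, h2, hsq, hσ2]; ring
          have h4 := mul_le_mul_of_nonneg_left hω (hr0 ω)
          have h5 := hsq ω
          rw [h3]
          nlinarith
      _ ≤ (∫⁻ ω, ENNReal.ofReal (Real.exp (σ / 2 * r ω * S ω
              - (epochLen V K (m + 1)) * ((σ / 2 * r ω) ^ 2 * (V * B.prob m ω k)))) ∂P)
            / ENNReal.ofReal (Real.exp (logBeta V K (m + 1))) :=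
          meas_ge_le_lintegral_div hm.aemeasurable (by simpa using hpos) ENNReal.ofReal_ne_top
      _ ≤ 1 / ENNReal.ofReal (Real.exp (logBeta V K (m + 1))) := by
          gcongr
      _ = ENNReal.ofReal (beta V K (m + 1) / 4) := by
          rw [← exp_neg_logBeta hV hK, Real.exp_neg, ENNReal.ofReal_inv_of_pos hpos, one_div]
  have hsub : B.badArm m k ⊆ {ω | V * pullCount V (m + 1) (B.state m ω) k * r ω ≤ 1 * S ω} ∪
      {ω | V * pullCount V (m + 1) (B.state m ω) k * r ω ≤ -1 * S ω} := by
    intro ω hω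
    have hω' : V * pullCount V (m + 1) (B.state m ω) k * r ω < |S ω| := hω
    rcases lt_abs.mp hω' with h | h
    · left; simp only [Set.mem_ofPred_eq]; linarith
    · right; simp only [Set.mem_ofPred_eq]; linarith
  have hβ := beta_pos hV hK (m + 1)
  calc P (B.badArm m k) ≤ _ := measure_mono hsub
    _ ≤ _ := measure_union_le _ _
    _ ≤ ENNReal.ofReal (beta V K (m + 1) / 4) + ENNReal.ofReal (beta V K (m + 1) / 4) :=
      add_le_add (tail 1 (by simp)) (tail (-1) (by simp))
    _ = _ := by
      rw [← ENNReal.ofReal_add (by positivity) (by positivity)]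
      congr 1
      ring

lemma measureReal_badEvent_le (B : Play V K ν P) (hB : B.FollowsMABarbat) (hV : 1 ≤ V)
    (hK : 2 ≤ K) (hν : ∀ᵐ x ∂ν, ∀ k, x k ∈ Set.Icc (0 : ℝ) 1) (m : ℕ) :
    P.real (B.badEvent m) ≤ delta V K (m + 1) / 2 := by
  have hβ := beta_pos hV hK (m + 1)
  have hδ := delta_pos hV hK (m + 1)
  have hV' : (1 : ℝ) ≤ V := by exact_mod_cast hV
  have hK' : (0 : ℝ) < K := by positivity
  have h1 (k : Fin K) : P.real (B.badArm m k) ≤ beta V K (m + 1) / 2 :=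
    ENNReal.toReal_le_of_le_ofReal (by positivity) (B.measure_badArm_le hB hV hK hν m k)
  calc P.real (B.badEvent m) ≤ ∑ k, P.real (B.badArm m k) := measureReal_iUnion_fintype_le _
    _ ≤ ∑ _ : Fin K, beta V K (m + 1) / 2 := Finset.sum_le_sum fun k _ => h1 k
    _ = delta V K (m + 1) / V / 2 := by
      rw [Finset.sum_const, Finset.card_univ, Fintype.card_fin, nsmul_eq_mul, beta]
      field_simp
    _ ≤ _ := by
      gcongr
      exact div_le_self hδ.le hV'

end Play

end MABarbat

end

noncomputable section

namespace MABarbat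

/-! ### The error of the estimates and the regret as a sum over epochs -/

lemma sum_pi_apply_mul_prod {ι κ : Type*} [Fintype ι] [DecidableEq ι] [Fintype κ] (v : ι)
    (f p : κ → ℝ) (hp : ∑ j, p j = 1) :
    ∑ a : ι → κ, f (a v) * ∏ u, p (a u) = ∑ j, f j * p j := by
  have h : ∏ u, ∑ j, (if u = v then f j else 1) * p j = ∑ j, f j * p j := by
    rw [Finset.prod_eq_single v]
    · simp
    · intro u _ hu
      simp [hu, hp]
    · simp
  classical
  rw [← h, Finset.prod_univ_sum, Fintype.piFinset_univ]
  refine Finset.sum_congr rfl fun a _ => ?_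
  rw [Finset.prod_mul_distrib]
  simp

lemma exists_epoch {V K : ℕ} (hV : 1 ≤ V) (hK : 2 ≤ K) (t : ℕ) :
    ∃ m, endTime V K m ≤ t ∧ t < endTime V K (m + 1) := by
  induction t with
  | zero => exact ⟨0, le_rfl, epochLen_succ_pos hV hK 0 |>.trans_le (by simp [endTime])⟩
  | succ t ih =>
    obtain ⟨m, h1, h2⟩ := ih
    rcases h2.nat_succ_le.eq_or_lt with h | h
    · exact ⟨m + 1, h.ge, h.trans_lt (endTime_strictMono hV hK (Nat.lt_succ_self _))⟩
    · exact ⟨m, h1.trans (Nat.le_succ t), h⟩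

namespace Play

variable {V K : ℕ} {ν : Measure (Fin K → ℝ)} {Ω : Type*} [mΩ : MeasurableSpace Ω]
  {P : Measure Ω}

lemma integral_reward [IsProbabilityMeasure ν] (B : Play V K ν P) (t : ℕ) (v : Fin V) (k : Fin K) :
    ∫ ω, B.reward t ω v k ∂P = mean ν k := by
  have hR : Measurable (B.reward t) := (B.measurable_reward t).mono (B.mid_le t) le_rfl
  have hf : Measurable fun r : Fin V → Fin K → ℝ => r v k := by fun_prop
  have h1 := integral_map (μ := P) hR.aemeasurable
    (f := fun r : Fin V → Fin K → ℝ => r v k) hf.aestronglyMeasurable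
  rw [← h1, B.law_reward t, mean]
  have h2 := measurePreserving_eval (fun _ : Fin V => ν) v
  have h3 := integral_map (μ := Measure.pi fun _ : Fin V => ν) h2.measurable.aemeasurable
    (f := fun x : Fin K → ℝ => x k) (measurable_pi_apply k).aestronglyMeasurable
  rw [h2.map_eq] at h3
  exact h3.symm

variable [NeZero K]

/-- The corruption in epoch `m + 1`. -/
def epochCorruption (B : Play V K ν P) (m : ℕ) (ω : Ω) : ℝ :=
  ∑ t ∈ Finset.Ico (endTime V K m) (endTime V K (m + 1)), ∑ v,
    Finset.univ.sup' Finset.univ_nonempty fun k : Fin K =>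
      |B.corrupted t ω v k - B.reward t ω v k|

/-- The error of the estimates of epoch `m` beyond the confidence radius: the average corruption,
and one more if an exceptional event happens. -/
def error (B : Play V K ν P) (ω : Ω) : ℕ → ℝ
  | 0 => 0
  | m + 1 => B.epochCorruption m ω / (V * epochLen V K (m + 1))
      + (B.badEvent m).indicator (fun _ => 1) ω

lemma abs_sub_le_sup (B : Play V K ν P) (t : ℕ) (ω : Ω) (v : Fin V) (k : Fin K) :
    |B.corrupted t ω v k - B.reward t ω v k| ≤ Finset.univ.sup' Finset.univ_nonempty
      fun k : Fin K => |B.corrupted t ω v k - B.reward t ω v k| :=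
  Finset.le_sup' (fun k : Fin K => |B.corrupted t ω v k - B.reward t ω v k|) (Finset.mem_univ k)

lemma sup_nonneg (B : Play V K ν P) (t : ℕ) (ω : Ω) (v : Fin V) :
    0 ≤ Finset.univ.sup' Finset.univ_nonempty
      fun k : Fin K => |B.corrupted t ω v k - B.reward t ω v k| :=
  (abs_nonneg _).trans (B.abs_sub_le_sup t ω v 0)

lemma epochCorruption_nonneg (B : Play V K ν P) (m : ℕ) (ω : Ω) : 0 ≤ B.epochCorruption m ω :=
  Finset.sum_nonneg fun t _ => Finset.sum_nonneg fun v _ => B.sup_nonneg t ω v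

lemma error_nonneg (B : Play V K ν P) (ω : Ω) (m : ℕ) : 0 ≤ B.error ω m := by
  cases m with
  | zero => exact le_rfl
  | succ m =>
    have := B.epochCorruption_nonneg m ω
    exact add_nonneg (by positivity) (Set.indicator_nonneg (fun _ _ => zero_le_one) ω)

/-- The corruption enters multiplied by the sampling probability rather than by the indicator of a
pull; the difference sits in the centred part. -/
lemma sum_messages_sub (B : Play V K ν P) (hV : 1 ≤ V) (hK : 2 ≤ K) (m : ℕ) (k : Fin K) (ω : Ω) :
    ∑ v, B.messages ω (m + 1) v k
        - V * pullCount V (m + 1) (B.state m ω) k * mean ν k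
      = ∑ t ∈ Finset.Ico (endTime V K m) (endTime V K (m + 1)), B.deviation (B.prob m) t k ω
        + B.prob m ω k * ∑ t ∈ Finset.Ico (endTime V K m) (endTime V K (m + 1)), ∑ v,
          (B.corrupted t ω v k - B.reward t ω v k) := by
  have h1 : ∑ v, B.messages ω (m + 1) v k
      = ∑ t ∈ Finset.Ico (endTime V K m) (endTime V K (m + 1)), ∑ v,
        (if B.arm t ω v = k then 1 else 0) * B.corrupted t ω v k := by
    simp only [messages, message, Nat.add_sub_cancel]
    rw [Finset.sum_comm]
    refine Finset.sum_congr rfl fun t _ => Finset.sum_congr rfl fun v _ => ?_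
    split_ifs with h
    · rw [h, one_mul]
    · rw [zero_mul]
  have h2 : V * pullCount V (m + 1) (B.state m ω) k * mean ν k
      = ∑ t ∈ Finset.Ico (endTime V K m) (endTime V K (m + 1)), ∑ _v : Fin V,
        B.prob m ω k * mean ν k := by
    rw [Finset.sum_const, Finset.sum_const, Finset.card_univ, Fintype.card_fin, Nat.card_Ico,
      show endTime V K (m + 1) - endTime V K m = epochLen V K (m + 1) by simp [endTime],
      nsmul_eq_mul, nsmul_eq_mul, ← epochLen_mul_armProb hV hK, prob]
    ring
  rw [h1, h2, ← Finset.sum_sub_distrib, Finset.mul_sum, ← Finset.sum_add_distrib]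
  refine Finset.sum_congr rfl fun t _ => ?_
  rw [deviation, ← Finset.sum_sub_distrib, Finset.mul_sum, ← Finset.sum_add_distrib]
  refine Finset.sum_congr rfl fun v _ => ?_
  ring

/-- Division by `V ñ_k = V N p_k` cancels the factor `p_k` before the corruption. On a bad event the
indicator in `error` suffices, as estimate and mean lie in `[0,1]`; elsewhere truncation at 1 only
brings the estimate closer to the mean. -/
lemma abs_est_sub_mean_le (B : Play V K ν P) (hV : 1 ≤ V) (hK : 2 ≤ K)
    (hμ : ∀ k, mean ν k ∈ Set.Icc (0 : ℝ) 1) {ω : Ω}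
    (hω : ∀ t v k, B.corrupted t ω v k ∈ Set.Icc (0 : ℝ) 1) (m : ℕ) (k : Fin K) :
    |(B.state (m + 1) ω).est k - mean ν k|
      ≤ B.error ω (m + 1) + radius V (m + 1) (B.state m ω) k := by
  have hr := radius_nonneg (V := V) (m + 1) (B.state m ω) k
  have hC := B.epochCorruption_nonneg m ω
  have hV' : (0 : ℝ) < V := by positivity
  have hN : (0 : ℝ) < epochLen V K (m + 1) := by exact_mod_cast epochLen_succ_pos hV hK m
  simp only [error]
  by_cases hbad : ω ∈ B.badEvent m
  · have h1 : (B.state (m + 1) ω).est k ≤ 1 := est_le_one _ _ _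
    have h2 : 0 ≤ (B.state (m + 1) ω).est k := est_nonneg hV hK (B.messages_nonneg hω) _ _
    have h3 : 0 ≤ B.epochCorruption m ω / (V * epochLen V K (m + 1)) := by positivity
    rw [Set.indicator_of_mem hbad, abs_le]
    constructor <;> linarith [(hμ k).1, (hμ k).2]
  · rw [Set.indicator_of_notMem hbad, add_zero]
    have hdev : |∑ t ∈ Finset.Ico (endTime V K m) (endTime V K (m + 1)),
        B.deviation (B.prob m) t k ω|
        ≤ V * pullCount V (m + 1) (B.state m ω) k * radius V (m + 1) (B.state m ω) k := by
      by_contra! h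
      exact hbad (Set.mem_iUnion.mpr ⟨k, h⟩)
    have hp := pullCount_pos hV hK (B.half_pow_le_state_gap m ω) k
    have hprob := B.prob_nonneg hV hK m ω k
    have hcorr : |∑ t ∈ Finset.Ico (endTime V K m) (endTime V K (m + 1)), ∑ v,
        (B.corrupted t ω v k - B.reward t ω v k)| ≤ B.epochCorruption m ω :=
      (Finset.abs_sum_le_sum_abs _ _).trans (Finset.sum_le_sum fun t _ =>
        (Finset.abs_sum_le_sum_abs _ _).trans (Finset.sum_le_sum fun v _ =>
          B.abs_sub_le_sup t ω v k))
    set n := pullCount V (m + 1) (B.state m ω) k with hn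
    have hx : |(∑ v, B.messages ω (m + 1) v k) / (V * n) - mean ν k|
        ≤ B.epochCorruption m ω / (V * epochLen V K (m + 1))
          + radius V (m + 1) (B.state m ω) k := by
      have h1 : (∑ v, B.messages ω (m + 1) v k) / (V * n) - mean ν k
          = (∑ v, B.messages ω (m + 1) v k - V * n * mean ν k) / (V * n) := by
        field_simp
      rw [h1, B.sum_messages_sub hV hK, abs_div, abs_of_pos (by positivity : 0 < V * n),
        div_le_iff₀ (by positivity)]
      refine (abs_add_le _ _).trans ?_
      rw [abs_mul, abs_of_nonneg hprob]
      have h2 : B.epochCorruption m ω / (V * epochLen V K (m + 1)) * (V * n)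
          = B.prob m ω k * B.epochCorruption m ω := by
        rw [prob, armProb, ← hn]
        field_simp
      rw [add_mul, h2]
      have h3 := mul_le_mul_of_nonneg_left hcorr hprob
      linarith
    have hmin : |min ((∑ v, B.messages ω (m + 1) v k) / (V * n)) 1 - mean ν k|
        ≤ |(∑ v, B.messages ω (m + 1) v k) / (V * n) - mean ν k| := by
      rcases le_total ((∑ v, B.messages ω (m + 1) v k) / (V * n)) 1 with h | h
      · rw [min_eq_left h]
      · rw [min_eq_right h, abs_of_nonneg (by linarith [(hμ k).2]),
          abs_of_nonneg (by linarith [(hμ k).2])]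
        linarith
    exact hmin.trans hx

end Play

end MABarbat

end

noncomputable section

namespace MABarbat

/-! ### The regret as a sum over epochs -/

namespace Play

variable {V K : ℕ} {ν : Measure (Fin K → ℝ)} {Ω : Type*} [mΩ : MeasurableSpace Ω]
  {P : Measure Ω}

lemma measurable_reward_arm (B : Play V K ν P) (t : ℕ) (v : Fin V) :
    Measurable fun ω => B.reward t ω v (B.arm t ω v) := by
  have h : (fun ω => B.reward t ω v (B.arm t ω v))
      = fun ω => ∑ k, if B.arm t ω v = k then B.reward t ω v k else 0 := by
    ext ω
    simp
  rw [h]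
  exact Finset.measurable_sum _ fun k _ =>
    Measurable.ite (B.past_le _ _ (B.measurableSet_arm_eq t v k))
      ((B.measurable_reward_mid t v k).mono (B.mid_le t) le_rfl) measurable_const

lemma integrable_prob [NeZero K] [IsProbabilityMeasure P] (B : Play V K ν P) (hV : 1 ≤ V) (hK : 2 ≤ K) (m : ℕ) (k : Fin K) :
    Integrable (fun ω => B.prob m ω k) P := by
  refine Integrable.of_bound (((B.measurable_prob hV hK m k).mono
    (B.past_le _) le_rfl).aestronglyMeasurable) 1 (ae_of_all _ fun ω => ?_)
  rw [Real.norm_eq_abs, abs_of_nonneg (B.prob_nonneg hV hK m ω k)]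
  exact B.prob_le_one hV hK m ω k

lemma integrable_epoch_regret [NeZero K] [IsProbabilityMeasure P] (B : Play V K ν P) (hV : 1 ≤ V) (hK : 2 ≤ K) (x : ℝ) (m : ℕ) :
    Integrable (fun ω => ∑ k, (x - mean ν k) * pullCount V (m + 1) (B.state m ω) k) P := by
  refine integrable_finsetSum _ fun k _ => ?_
  have h := ((B.integrable_prob hV hK m k).const_mul (epochLen V K (m + 1) : ℝ)).const_mul
    (x - mean ν k)
  refine h.congr (ae_of_all _ fun ω => ?_)
  simp only [prob]
  rw [epochLen_mul_armProb hV hK]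

variable [IsProbabilityMeasure ν] [IsProbabilityMeasure P]

lemma integrable_reward_play (B : Play V K ν P) (hν : ∀ᵐ x ∂ν, ∀ k, x k ∈ Set.Icc (0 : ℝ) 1)
    (t : ℕ) (v : Fin V) (k : Fin K) : Integrable (fun ω => B.reward t ω v k) P := by
  refine Integrable.of_bound (((B.measurable_reward_mid t v k).mono
    (B.mid_le t) le_rfl).aestronglyMeasurable) 1 ?_
  filter_upwards [B.ae_reward_mem hν] with ω hω
  rw [Real.norm_eq_abs, abs_le]
  exact ⟨by linarith [(hω t v k).1], (hω t v k).2⟩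

lemma integrable_reward_arm (B : Play V K ν P) (hν : ∀ᵐ x ∂ν, ∀ k, x k ∈ Set.Icc (0 : ℝ) 1)
    (t : ℕ) (v : Fin V) : Integrable (fun ω => B.reward t ω v (B.arm t ω v)) P := by
  refine Integrable.of_bound (B.measurable_reward_arm t v).aestronglyMeasurable 1 ?_
  filter_upwards [B.ae_reward_mem hν] with ω hω
  rw [Real.norm_eq_abs, abs_le]
  exact ⟨by linarith [(hω t v (B.arm t ω v)).1], (hω t v _).2⟩

variable [NeZero K]

/-- The arm is averaged out given `mid t`; then the reward is independent of the sampling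
distribution, which was fixed before the round. True rewards are integrated, so the corruption acts
only through the distribution. -/
lemma integral_reward_arm (B : Play V K ν P) (hB : B.FollowsMABarbat) (hV : 1 ≤ V) (hK : 2 ≤ K)
    (hν : ∀ᵐ x ∂ν, ∀ k, x k ∈ Set.Icc (0 : ℝ) 1) (v : Fin V) {m t : ℕ}
    (h1 : endTime V K m ≤ t) (h2 : t < endTime V K (m + 1)) :
    ∫ ω, B.reward t ω v (B.arm t ω v) ∂P = ∑ k, mean ν k * ∫ ω, B.prob m ω k ∂P := by
  have hRm (k : Fin K) : Measurable fun ω => B.reward t ω v k :=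
    (B.measurable_reward_mid t v k).mono (B.mid_le t) le_rfl
  have hpm (k : Fin K) : Measurable fun ω => B.prob m ω k :=
    (B.measurable_prob hV hK m k).mono (B.past_le _) le_rfl
  have hind (k : Fin K) : IndepFun (fun ω => B.reward t ω v k) (fun ω => B.prob m ω k) P := by
    rw [IndepFun_iff_Indep]
    refine (indep_of_indep_of_le_left (indep_of_indep_of_le_right (B.indep_reward t) ?_) ?_).symm
    · have : Measurable[MeasurableSpace.comap (B.reward t) inferInstance]
          fun ω => B.reward t ω v k :=
        (show Measurable fun r : Fin V → Fin K → ℝ => r v k by fun_prop).comp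
          (comap_measurable (B.reward t))
      exact this.comap_le
    · exact ((B.measurable_prob hV hK m k).mono (B.past_mono h1) le_rfl).comap_le
  have hprod (k : Fin K) : Integrable (fun ω => B.reward t ω v k * B.prob m ω k) P :=
    (hind k).integrable_mul (B.integrable_reward_play hν t v k)
      (B.integrable_prob hV hK m k)
  have hsum : ∫ ω, ∑ k, B.reward t ω v k * B.prob m ω k ∂P
      = ∑ k, mean ν k * ∫ ω, B.prob m ω k ∂P := by
    rw [integral_finsetSum _ fun k _ => hprod k]
    refine Finset.sum_congr rfl fun k _ => ?_
    rw [(hind k).integral_fun_mul_eq_mul_integral (hRm k).aestronglyMeasurable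
      (hpm k).aestronglyMeasurable, B.integral_reward t v k]
  have hmem := B.ae_reward_mem hν
  have hsm : Measurable fun ω => ∑ k, B.reward t ω v k * B.prob m ω k :=
    Finset.measurable_sum _ fun k _ => (hRm k).mul (hpm k)
  rw [← hsum, integral_eq_lintegral_of_nonneg_ae
      (by filter_upwards [hmem] with ω hω using (hω t v _).1)
      (B.measurable_reward_arm t v).aestronglyMeasurable,
    integral_eq_lintegral_of_nonneg_ae
      (by filter_upwards [hmem] with ω hω using Finset.sum_nonneg fun k _ =>
        mul_nonneg (hω t v k).1 (B.prob_nonneg hV hK m ω k))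
      hsm.aestronglyMeasurable]
  congr 1
  rw [lintegral_sampled (B.mid_le t) ((B.measurable_arm t).mono (B.past_le _) le_rfl)
    (hB m t h1 h2) (g := fun a ω => ENNReal.ofReal (B.reward t ω v (a v)))
    (fun a => (B.measurable_reward_mid t v (a v)).ennreal_ofReal)]
  refine lintegral_congr_ae ?_
  filter_upwards [hmem] with ω hω
  rw [← sum_pi_apply_mul_prod v (fun k => B.reward t ω v k) (B.prob m ω) (B.sum_prob hV hK m ω),
    ENNReal.ofReal_sum_of_nonneg fun a _ => mul_nonneg (hω t v _).1
      (Finset.prod_nonneg fun u _ => B.prob_nonneg hV hK m ω _)]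
  refine Finset.sum_congr rfl fun a _ => ?_
  rw [ENNReal.ofReal_mul (hω t v _).1]
  rfl

/-- The regret of epoch `m + 1` is the expected number of pulls of each arm, weighted by gaps. -/
lemma epochLen_mul_round_regret (B : Play V K ν P) (hB : B.FollowsMABarbat) (hV : 1 ≤ V)
    (hK : 2 ≤ K) (hν : ∀ᵐ x ∂ν, ∀ k, x k ∈ Set.Icc (0 : ℝ) 1) (v : Fin V) (x : ℝ) {m t : ℕ}
    (h1 : endTime V K m ≤ t) (h2 : t < endTime V K (m + 1)) :
    epochLen V K (m + 1) * (x - ∫ ω, B.reward t ω v (B.arm t ω v) ∂P)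
      = ∫ ω, ∑ k, (x - mean ν k) * pullCount V (m + 1) (B.state m ω) k ∂P := by
  have hi (k : Fin K) := B.integrable_prob hV hK m k
  have hone : ∑ k, ∫ ω, B.prob m ω k ∂P = 1 := by
    rw [← integral_finsetSum _ fun k _ => hi k]
    simp [B.sum_prob hV hK m]
  rw [B.integral_reward_arm hB hV hK hν v h1 h2]
  have h3 : x - ∑ k, mean ν k * ∫ ω, B.prob m ω k ∂P
      = ∑ k, (x - mean ν k) * ∫ ω, B.prob m ω k ∂P := by
    simp_rw [sub_mul]
    rw [Finset.sum_sub_distrib, ← Finset.mul_sum, hone, mul_one]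
  have h4 (ω : Ω) : ∑ k, (x - mean ν k) * pullCount V (m + 1) (B.state m ω) k
      = epochLen V K (m + 1) * ∑ k, (x - mean ν k) * B.prob m ω k := by
    rw [Finset.mul_sum]
    refine Finset.sum_congr rfl fun k _ => ?_
    rw [← epochLen_mul_armProb hV hK, prob]
    ring
  simp_rw [h4]
  rw [h3, integral_const_mul, integral_finsetSum _ fun k _ => (hi k).const_mul _]
  simp_rw [integral_const_mul]

lemma regret_eq_sum (B : Play V K ν P) (hν : ∀ᵐ x ∂ν, ∀ k, x k ∈ Set.Icc (0 : ℝ) 1)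
    {best : Fin K} (hbest : ∀ k, mean ν k ≤ mean ν best) (v : Fin V) (T : ℕ) :
    B.regret v T
      = ∑ t ∈ Finset.range T, (mean ν best - ∫ ω, B.reward t ω v (B.arm t ω v) ∂P) := by
  have h1 (k : Fin K) : ∫ ω, ∑ t ∈ Finset.range T, B.reward t ω v k ∂P = T * mean ν k := by
    rw [integral_finsetSum _ fun t _ => B.integrable_reward_play hν t v k]
    simp [B.integral_reward]
  rw [regret, integral_finsetSum _ fun t _ => B.integrable_reward_arm hν t v,
    Finset.sum_sub_distrib]
  congr 1
  simp_rw [h1]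
  rw [Finset.sum_const, Finset.card_range, nsmul_eq_mul]
  refine le_antisymm (Finset.sup'_le _ _ fun k _ => ?_)
    (Finset.le_sup' (fun k => (T : ℝ) * mean ν k) (Finset.mem_univ best))
  exact mul_le_mul_of_nonneg_left (hbest k) (Nat.cast_nonneg T)

lemma round_regret_nonneg (B : Play V K ν P) (hν : ∀ᵐ x ∂ν, ∀ k, x k ∈ Set.Icc (0 : ℝ) 1)
    (hB : B.FollowsMABarbat) (hV : 1 ≤ V) (hK : 2 ≤ K)
    {best : Fin K} (hbest : ∀ k, mean ν k ≤ mean ν best) (v : Fin V) (t : ℕ) :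
    0 ≤ mean ν best - ∫ ω, B.reward t ω v (B.arm t ω v) ∂P := by
  obtain ⟨m, h1, h2⟩ := exists_epoch hV hK t
  have hN : (0 : ℝ) < epochLen V K (m + 1) := by exact_mod_cast epochLen_succ_pos hV hK m
  have h := B.epochLen_mul_round_regret hB hV hK hν v (mean ν best) h1 h2
  refine nonneg_of_mul_nonneg_right ?_ hN
  rw [h]
  exact integral_nonneg fun ω => Finset.sum_nonneg fun k _ =>
    mul_nonneg (sub_nonneg.mpr (hbest k)) (pullCount_pos hV hK (B.half_pow_le_state_gap m ω) k).le

lemma regret_le_sum_epochs (B : Play V K ν P) (hν : ∀ᵐ x ∂ν, ∀ k, x k ∈ Set.Icc (0 : ℝ) 1)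
    (hB : B.FollowsMABarbat) (hV : 1 ≤ V) (hK : 2 ≤ K)
    {best : Fin K} (hbest : ∀ k, mean ν k ≤ mean ν best) (v : Fin V) {T M : ℕ}
    (hT : T ≤ endTime V K M) :
    B.regret v T ≤ ∫ ω, ∑ m ∈ Finset.range M,
      ∑ k, (mean ν best - mean ν k) * pullCount V (m + 1) (B.state m ω) k ∂P := by
  rw [B.regret_eq_sum hν hbest,
    integral_finsetSum _ fun m _ => B.integrable_epoch_regret hV hK _ m]
  -- Every round has nonnegative expected regret, so the last epoch may be completed.
  refine (Finset.sum_le_sum_of_subset_of_nonneg (Finset.range_mono hT)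
    fun t _ _ => B.round_regret_nonneg hν hB hV hK hbest v t).trans (le_of_eq ?_)
  clear hT
  induction M with
  | zero => simp [endTime]
  | succ M ih =>
    rw [Finset.sum_range_succ, ← ih, Finset.range_eq_Ico, Finset.range_eq_Ico,
      ← Finset.sum_Ico_consecutive _ (Nat.zero_le _)
        ((endTime_strictMono hV hK).monotone (Nat.le_succ M))]
    congr 1
    have hN : (0 : ℝ) < epochLen V K (M + 1) := by exact_mod_cast epochLen_succ_pos hV hK M
    have hround : ∀ t ∈ Finset.Ico (endTime V K M) (endTime V K (M + 1)),
        mean ν best - ∫ ω, B.reward t ω v (B.arm t ω v) ∂P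
          = (∫ ω, ∑ k, (mean ν best - mean ν k) * pullCount V (M + 1) (B.state M ω) k ∂P)
            / epochLen V K (M + 1) := by
      intro t ht
      rw [Finset.mem_Ico] at ht
      rw [eq_div_iff hN.ne', mul_comm]
      exact B.epochLen_mul_round_regret hB hV hK hν v _ ht.1 ht.2
    rw [Finset.sum_congr rfl hround, Finset.sum_const, Nat.card_Ico,
      show endTime V K (M + 1) - endTime V K M = epochLen V K (M + 1) by simp [endTime],
      nsmul_eq_mul]
    field_simp

end Play

end MABarbat

end

noncomputable section

namespace MABarbat

/-! ### Sums of the parameters over epochs -/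

lemma sum_half_pow_le (M : ℕ) : ∑ m ∈ Finset.range M, (1 / 2 : ℝ) ^ m ≤ 2 := by
  have h : (0 : ℝ) < (1 / 2) ^ M := by positivity
  rw [geom_sum_eq (by norm_num), show (1 / 2 : ℝ) - 1 = -(1 / 2) by norm_num,
    div_le_iff_of_neg (by norm_num)]
  linarith

lemma sum_two_pow_le (M : ℕ) {x : ℝ} (hx : 0 ≤ x) :
    ∑ m ∈ Finset.range M, (if (2 : ℝ) ^ m < x then (2 : ℝ) ^ m else 0) ≤ 2 * x := by
  have h (M : ℕ) : ∑ m ∈ Finset.range M, (if (2 : ℝ) ^ m < x then (2 : ℝ) ^ m else 0) ≤ 2 ^ M := by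
    induction M with
    | zero => simp
    | succ M ih =>
      rw [Finset.sum_range_succ, pow_succ]
      split_ifs
      · linarith
      · have : (0 : ℝ) < 2 ^ M := by positivity
        linarith
  induction M with
  | zero => simpa using hx
  | succ M ih =>
    rw [Finset.sum_range_succ]
    split_ifs with hM
    · linarith [h M]
    · linarith

section Parameters

variable {V K : ℕ}

/-- Each term is at most `256 · 18 · 2 = 9216` times `log(KVT)/V`, and there are at most `3 log(VT)`
of them. The assumption `VT ≥ 2` keeps `log(VT) ≥ 1/2`, which absorbs the additional epoch in
progress. -/
lemma sum_lam_le (hV : 1 ≤ V) (hK : 2 ≤ K) {T M : ℕ} (hM : ∀ m < M, endTime V K m < T)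
    (hVT : 2 ≤ V * T) :
    ∑ m ∈ Finset.range M, lam V K (m + 1)
      ≤ 27648 * (Real.log ((V : ℝ) * T) * Real.log ((K : ℝ) * V * T) / V) := by
  have hVT' : (2 : ℝ) ≤ (V : ℝ) * T := by exact_mod_cast hVT
  have hV' : (1 : ℝ) ≤ V := by exact_mod_cast hV
  have hK' : (2 : ℝ) ≤ K := by exact_mod_cast hK
  have hlog : 1 / 2 ≤ Real.log ((V : ℝ) * T) := by
    have := Real.log_le_log (by norm_num) hVT'
    linarith [Real.log_two_gt_d9]
  have hKVT : (V : ℝ) * T ≤ (K : ℝ) * V * T := by nlinarith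
  have hlog' : 0 ≤ Real.log ((K : ℝ) * V * T) := Real.log_nonneg (by linarith)
  have hlam (m : ℕ) (hm : m ∈ Finset.range M) :
      lam V K (m + 1) ≤ 9216 * Real.log ((K : ℝ) * V * T) / V := by
    rw [lam_eq]
    gcongr ?_ / _
    have h4 := four_pow_le_mul_of_endTime_lt hV hK (hM m (Finset.mem_range.mp hm))
    have h2 : (2 : ℝ) ^ m ≤ V * T := le_trans (by gcongr; norm_num) h4
    have hT : 1 ≤ T := by
      rcases Nat.eq_zero_or_pos T with rfl | h
      · simp at hVT
      · exact h
    have hT' : (1 : ℝ) ≤ T := by exact_mod_cast hT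
    have h3 : (K : ℝ) * V * 2 ^ m ≤ ((K : ℝ) * V * T) ^ 2 := by
      calc (K : ℝ) * V * 2 ^ m ≤ (K : ℝ) * V * (V * T) := by gcongr
        _ ≤ ((K : ℝ) * V * T) * (K * V * T) := by
          refine mul_le_mul ?_ hKVT (by positivity) (by positivity)
          exact le_mul_of_one_le_right (by positivity) hT'
        _ = _ := by ring
    have h5 := Real.log_le_log (by positivity) h3
    rw [Real.log_pow] at h5
    have h6 := logTerm_succ_le_log hV hK m
    push_cast at h5
    linarith
  have hMle : (M : ℝ) ≤ 3 * Real.log ((V : ℝ) * T) := by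
    rcases M with _ | n
    · simp; linarith
    · have h4 := four_pow_le_mul_of_endTime_lt hV hK (hM n (Nat.lt_succ_self n))
      have h5 := Real.log_le_log (by positivity) h4
      rw [Real.log_pow] at h5
      have h6 : (1 : ℝ) ≤ Real.log 4 := by
        rw [Real.le_log_iff_exp_le (by norm_num)]
        linarith [Real.exp_one_lt_d9]
      have h7 : (n : ℝ) ≤ n * Real.log 4 := le_mul_of_one_le_right (Nat.cast_nonneg n) h6
      push_cast
      linarith
  refine (Finset.sum_le_card_nsmul _ _ _ hlam).trans ?_
  rw [Finset.card_range, nsmul_eq_mul]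
  calc (M : ℝ) * (9216 * Real.log ((K : ℝ) * V * T) / V)
      ≤ 3 * Real.log ((V : ℝ) * T) * (9216 * Real.log ((K : ℝ) * V * T) / V) := by gcongr
    _ = _ := by ring

/-- Powers of 2 below `9/(2Δ)` sum to at most `9/Δ`, so no factor counting epochs arises. The factor
`log(1/Δ)` is inserted at the end, being at least `1/2` when `Δ ≤ 1/2`; for larger `Δ` the cost is
zero. -/
lemma sum_leaderCost_le (hV : 1 ≤ V) (hK : 2 ≤ K) {Δ : ℝ} (hΔ : 0 < Δ) (hΔ1 : Δ ≤ 1) (M : ℕ) :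
    ∑ m ∈ Finset.range M, leaderCost V K Δ m
      ≤ 746496 * ((K : ℝ) * Real.log (1 / Δ) * Real.log ((K : ℝ) * V / Δ) / (V * Δ)) + 6 := by
  have hV' : (1 : ℝ) ≤ V := by exact_mod_cast hV
  have hK' : (2 : ℝ) ≤ K := by exact_mod_cast hK
  have hKV : (2 : ℝ) ≤ (K : ℝ) * V := by nlinarith
  have hlog1 : 0 ≤ Real.log (1 / Δ) := Real.log_nonneg (by rw [le_div_iff₀ hΔ]; linarith)
  have hlog2 : 0 ≤ Real.log ((K : ℝ) * V / Δ) :=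
    Real.log_nonneg (by rw [le_div_iff₀ hΔ]; linarith)
  by_cases hhalf : Δ ≤ 1 / 2
  · set Q : ℝ := 13824 * Real.log ((K : ℝ) * V / Δ) / V with hQ
    have hQ0 : 0 ≤ Q := by positivity
    have hterm (m : ℕ) : leaderCost V K Δ m
        ≤ 3 * K * Q * (if (2 : ℝ) ^ m < 9 / (2 * Δ) then (2 : ℝ) ^ m else 0) + 3 * (1 / 2) ^ m := by
      unfold leaderCost
      have hiff : (2 : ℝ) ^ m * Δ < 9 / 2 ↔ (2 : ℝ) ^ m < 9 / (2 * Δ) := by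
        have h2Δ : 0 < 2 * Δ := by positivity
        rw [lt_div_iff₀ h2Δ]
        constructor <;> intro h <;> linarith
      by_cases hm : (2 : ℝ) ^ m < 9 / (2 * Δ)
      · rw [if_pos ⟨hhalf, hiff.mpr hm⟩, if_pos hm]
        have hlam : lam V K (m + 1) ≤ Q := by
          rw [lam_eq, hQ]
          gcongr ?_ / _
          have h4 : (4 : ℝ) ≤ (K : ℝ) * V / Δ := by
            rw [le_div_iff₀ hΔ]; linarith
          have h3 : (K : ℝ) * V * 2 ^ m ≤ ((K : ℝ) * V / Δ) ^ 3 := by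
            calc (K : ℝ) * V * 2 ^ m ≤ (K : ℝ) * V * (9 / (2 * Δ)) := by gcongr
              _ = (K : ℝ) * V / Δ * (9 / 2) := by field_simp
              _ ≤ (K : ℝ) * V / Δ * ((K : ℝ) * V / Δ) ^ 2 := by
                gcongr
                nlinarith
              _ = _ := by ring
          have h5 := Real.log_le_log (by positivity) h3
          rw [Real.log_pow] at h5
          have h6 := logTerm_succ_le_log hV hK m
          push_cast at h5
          linarith
        have : (K : ℝ) * lam V K (m + 1) * 2 ^ m ≤ K * Q * 2 ^ m := by gcongr
        linarith
      · rw [if_neg fun h => hm (hiff.mp h.2)]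
        positivity
    have hlog3 : 1 / 2 ≤ Real.log (1 / Δ) := by
      have := Real.log_le_log (by norm_num) (show (2 : ℝ) ≤ 1 / Δ by
        rw [le_div_iff₀ hΔ]; linarith)
      linarith [Real.log_two_gt_d9]
    calc ∑ m ∈ Finset.range M, leaderCost V K Δ m
        ≤ ∑ m ∈ Finset.range M, (3 * K * Q * (if (2 : ℝ) ^ m < 9 / (2 * Δ) then (2 : ℝ) ^ m else 0)
          + 3 * (1 / 2) ^ m) := Finset.sum_le_sum fun m _ => hterm m
      _ = 3 * K * Q * (∑ m ∈ Finset.range M,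
            (if (2 : ℝ) ^ m < 9 / (2 * Δ) then (2 : ℝ) ^ m else 0))
          + 3 * ∑ m ∈ Finset.range M, (1 / 2 : ℝ) ^ m := by
        rw [Finset.sum_add_distrib, ← Finset.mul_sum, ← Finset.mul_sum]
      _ ≤ 3 * K * Q * (2 * (9 / (2 * Δ))) + 3 * 2 := by
        gcongr
        · exact sum_two_pow_le M (by positivity)
        · exact sum_half_pow_le M
      _ = 746496 * ((K : ℝ) * (1 / 2) * Real.log ((K : ℝ) * V / Δ) / (V * Δ)) + 6 := by
        rw [hQ]; field_simp; ring
      _ ≤ _ := by gcongr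
  · have h0 : ∑ m ∈ Finset.range M, leaderCost V K Δ m = 0 :=
      Finset.sum_eq_zero fun m _ => by rw [leaderCost, if_neg fun h => hhalf h.1]
    rw [h0]
    positivity

/-- Because `ζ` grows at least like `4^m`, the product `K 4^m δ` is at most 1. Bad events thus cost
no more than the sum of the `λ`, up to a constant. -/
lemma epochLen_mul_delta_le (hV : 1 ≤ V) (hK : 2 ≤ K) (m : ℕ) :
    epochLen V K (m + 1) * (delta V K (m + 1) / 2) ≤ lam V K (m + 1) + (1 / 2) ^ m := by
  have hl := lam_pos hV hK (m + 1)
  have hδ := delta_pos hV hK (m + 1)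
  have hN := epochLen_succ_le hV hK m
  have hz := four_pow_le_zeta hV hK (m + 1)
  have hz0 := zeta_pos hV hK (m + 1)
  have hV' : (1 : ℝ) ≤ V := by exact_mod_cast hV
  have hK' : (2 : ℝ) ≤ K := by exact_mod_cast hK
  have h4 : (0 : ℝ) < 4 ^ m := by positivity
  have hz' : (4 : ℝ) ^ m ≤ zeta V K (m + 1) := by rw [pow_succ] at hz; linarith
  have h1 : K * 4 ^ m * delta V K (m + 1) ≤ 1 := by
    rw [delta, mul_one_div, div_le_one (by positivity)]
    have : (K : ℝ) ≤ V * K := by nlinarith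
    gcongr
  have h2 : delta V K (m + 1) ≤ (1 / 2) ^ m := by
    have h3 : (4 : ℝ) ^ m * delta V K (m + 1) ≤ 1 :=
      le_trans (by nlinarith [mul_pos h4 hδ]) h1
    have h5 : (2 : ℝ) ^ m * delta V K (m + 1) ≤ 1 :=
      le_trans (by gcongr; norm_num) h3
    rw [one_div, inv_pow, ← one_div, le_div_iff₀ (by positivity)]
    linarith
  have h3 := mul_le_mul_of_nonneg_right hN hδ.le
  have h5 := mul_le_mul_of_nonneg_left h1 hl.le
  nlinarith

end Parameters

/-! ### The regret bound -/

section Gap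

variable {K : ℕ} [NeZero K] {ν : Measure (Fin K → ℝ)}

lemma gap_eq {best : Fin K} (hbest : ∀ k, mean ν k ≤ mean ν best) (k : Fin K) :
    gap ν k = mean ν best - mean ν k := by
  unfold gap
  congr 1
  exact le_antisymm (Finset.sup'_le _ _ fun j _ => hbest j)
    (Finset.le_sup' (mean ν) (Finset.mem_univ best))

lemma minGap_mem (h : ∃ k, 0 < gap ν k) : 0 < minGap ν ∧ ∃ k, gap ν k = minGap ν := by
  have hfin : {x | 0 < x ∧ ∃ k, gap ν k = x}.Finite :=
    (Set.finite_range (gap ν)).subset fun x hx => hx.2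
  obtain ⟨k, hk⟩ := h
  have hne : {x | 0 < x ∧ ∃ k, gap ν k = x}.Nonempty := ⟨gap ν k, hk, k, rfl⟩
  exact hne.csInf_mem hfin

lemma minGap_le {k : Fin K} (hk : 0 < gap ν k) : minGap ν ≤ gap ν k :=
  csInf_le ⟨0, fun _ hx => hx.1.le⟩ ⟨hk, k, rfl⟩

end Gap

namespace Play

variable {V K : ℕ} {ν : Measure (Fin K → ℝ)} {Ω : Type*} [mΩ : MeasurableSpace Ω]
  {P : Measure Ω} [NeZero K]

lemma corruption_nonneg (B : Play V K ν P) (T : ℕ) (ω : Ω) : 0 ≤ B.corruption T ω :=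
  Finset.sum_nonneg fun t _ => Finset.sum_nonneg fun v _ => B.sup_nonneg t ω v

lemma sum_epochCorruption_le (B : Play V K ν P) (hV : 1 ≤ V) (hK : 2 ≤ K) {n T : ℕ}
    (hn : endTime V K n ≤ T) (ω : Ω) :
    ∑ m ∈ Finset.range n, B.epochCorruption m ω ≤ B.corruption T ω := by
  refine le_trans (le_of_eq ?_) (Finset.sum_le_sum_of_subset_of_nonneg (Finset.range_mono hn)
    fun t _ _ => Finset.sum_nonneg fun v _ => B.sup_nonneg t ω v)
  clear hn
  induction n with
  | zero => simp [endTime]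
  | succ n ih =>
    rw [Finset.sum_range_succ, ih, Finset.range_eq_Ico, Finset.range_eq_Ico,
      ← Finset.sum_Ico_consecutive _ (Nat.zero_le _)
        ((endTime_strictMono hV hK).monotone (Nat.le_succ n))]
    rfl

variable [IsProbabilityMeasure ν] [IsProbabilityMeasure P]

lemma integrable_corruption (B : Play V K ν P) (hν : ∀ᵐ x ∂ν, ∀ k, x k ∈ Set.Icc (0 : ℝ) 1)
    (T : ℕ) : Integrable (B.corruption T) P := by
  refine integrable_finsetSum _ fun t _ => integrable_finsetSum _ fun v _ => ?_
  have hm : Measurable fun ω => Finset.univ.sup' Finset.univ_nonempty fun k : Fin K =>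
      |B.corrupted t ω v k - B.reward t ω v k| := by
    have h := Finset.measurable_sup' (s := (Finset.univ : Finset (Fin K)))
      Finset.univ_nonempty (f := fun k ω => |B.corrupted t ω v k - B.reward t ω v k|)
      (fun k _ => (((B.measurable_corrupted_mid t v k).sub
        (B.measurable_reward_mid t v k)).mono (B.mid_le t) le_rfl).norm)
    convert h using 1
    ext ω
    rw [Finset.sup'_apply]
  refine Integrable.of_bound hm.aestronglyMeasurable 1 ?_
  filter_upwards [B.ae_reward_mem hν, B.ae_corrupted_mem] with ω h1 h2
  rw [Real.norm_eq_abs, abs_of_nonneg (B.sup_nonneg t ω v)]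
  refine Finset.sup'_le _ _ fun k _ => ?_
  rw [abs_le]
  constructor <;> linarith [(h1 t v k).1, (h1 t v k).2, (h2 t v k).1, (h2 t v k).2]

/-- The regret in terms of the sums of the parameters over the epochs `1, …, M`. -/
lemma regret_le_of_epochs (B : Play V K ν P) (hB : B.FollowsMABarbat) (hV : 1 ≤ V) (hK : 2 ≤ K)
    (hν : ∀ᵐ x ∂ν, ∀ k, x k ∈ Set.Icc (0 : ℝ) 1)
    {best : Fin K} (hbest : ∀ k, mean ν k ≤ mean ν best) {Δ : ℝ}
    (hΔ : ∀ k, 0 < mean ν best - mean ν k → Δ ≤ mean ν best - mean ν k)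
    (v : Fin V) {T M : ℕ} (hT : T ≤ endTime V K M) (hM : ∀ m < M, endTime V K m < T) :
    B.regret v T ≤ 100 * (∑ m ∈ Finset.range M, lam V K (m + 1))
          * (∑ k, (mean ν best - mean ν k)⁻¹)
        + 1650 * ((∫ ω, B.corruption T ω ∂P) / V + (∑ m ∈ Finset.range M, lam V K (m + 1)) + 2)
        + ∑ m ∈ Finset.range M, leaderCost V K Δ m + 1 := by
  have hV' : (0 : ℝ) < V := by positivity
  have hμ (k : Fin K) := mean_mem hν k
  set Λ := ∑ m ∈ Finset.range M, lam V K (m + 1) with hΛ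
  set G := ∑ k, (mean ν best - mean ν k)⁻¹ with hG
  have hbadm (m : ℕ) := B.measurableSet_badEvent hV hK m
  -- Only errors of the first `M - 1` epochs are charged. These epochs end by time `T`, so the
  -- corruption up to `T` covers them even if epoch `M` runs past `T`.
  have hend : endTime V K (M - 1) ≤ T := by
    rcases M with _ | n
    · simp [endTime]
    · exact (hM n (Nat.lt_succ_self n)).le
  have hind (m : ℕ) : Integrable (fun ω => (epochLen V K (m + 1) : ℝ) *
      (B.badEvent m).indicator (fun _ => (1 : ℝ)) ω) P :=
    ((integrable_const (1 : ℝ)).indicator (hbadm m)).const_mul _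
  have hcint := (B.integrable_corruption hν T).div_const (V : ℝ)
  set U : Ω → ℝ := fun ω => B.corruption T ω / V + ∑ m ∈ Finset.range (M - 1),
    (epochLen V K (m + 1) : ℝ) * (B.badEvent m).indicator (fun _ => (1 : ℝ)) ω with hU
  have hUint : Integrable U P := hcint.add (integrable_finsetSum _ fun m _ => hind m)
  have hpath : ∀ᵐ ω ∂P, ∑ m ∈ Finset.range M,
      ∑ k, (mean ν best - mean ν k) * pullCount V (m + 1) (B.state m ω) k
      ≤ 1650 * U ω + (100 * Λ * G + ∑ m ∈ Finset.range M, leaderCost V K Δ m + 1) := by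
    filter_upwards [B.ae_corrupted_mem] with ω hω
    have hstep (m : ℕ) := epoch_regret_le hV hK (B.messages_nonneg hω) (B.error_nonneg ω) hbest hμ
      hΔ (B.abs_est_sub_mean_le hV hK hμ hω) m
    have h1 := Finset.sum_le_sum fun m (_ : m ∈ Finset.range M) => hstep m
    rw [Finset.sum_add_distrib, Finset.sum_add_distrib, Finset.sum_add_distrib, ← Finset.sum_mul,
      ← Finset.mul_sum, ← Finset.mul_sum] at h1
    have h2 := sum_epochLen_mul_discounted_le hV hK (B.error_nonneg ω) M
    have h3 : ∑ m ∈ Finset.range M, (if m = 0 then (1 : ℝ) else 0) ≤ 1 := by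
      rw [Finset.sum_ite_eq']
      split_ifs <;> norm_num
    have h4 : ∑ m ∈ Finset.range (M - 1), (epochLen V K (m + 1) : ℝ) * B.error ω (m + 1)
        ≤ U ω := by
      have h5 (m : ℕ) : (epochLen V K (m + 1) : ℝ) * B.error ω (m + 1)
          = B.epochCorruption m ω / V
            + (epochLen V K (m + 1) : ℝ) * (B.badEvent m).indicator (fun _ => (1 : ℝ)) ω := by
        have hN : (0 : ℝ) < epochLen V K (m + 1) := by exact_mod_cast epochLen_succ_pos hV hK m
        rw [error, mul_add]
        congr 1
        field_simp
      simp_rw [h5]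
      rw [Finset.sum_add_distrib, ← Finset.sum_div]
      exact add_le_add (div_le_div_of_nonneg_right
        (B.sum_epochCorruption_le hV hK hend ω) hV'.le) le_rfl
    refine h1.trans ?_
    linarith
  have hUle : ∫ ω, U ω ∂P ≤ (∫ ω, B.corruption T ω ∂P) / V + Λ + 2 := by
    have h1 : ∫ ω, U ω ∂P = (∫ ω, B.corruption T ω ∂P) / V
        + ∑ m ∈ Finset.range (M - 1), epochLen V K (m + 1) * P.real (B.badEvent m) := by
      rw [hU, integral_add hcint (integrable_finsetSum _ fun m _ => hind m), integral_div,
        integral_finsetSum _ fun m _ => hind m]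
      congr 1
      refine Finset.sum_congr rfl fun m _ => ?_
      rw [integral_const_mul, integral_indicator_const _ (hbadm m)]
      simp
    have h2 : ∑ m ∈ Finset.range (M - 1), epochLen V K (m + 1) * P.real (B.badEvent m)
        ≤ ∑ m ∈ Finset.range M, (lam V K (m + 1) + (1 / 2) ^ m) := by
      calc _ ≤ ∑ m ∈ Finset.range (M - 1), (lam V K (m + 1) + (1 / 2) ^ m) := by
            refine Finset.sum_le_sum fun m _ => ?_
            refine le_trans ?_ (epochLen_mul_delta_le hV hK m)
            gcongr
            exact B.measureReal_badEvent_le hB hV hK hν m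
        _ ≤ _ := Finset.sum_le_sum_of_subset_of_nonneg (Finset.range_mono (Nat.sub_le M 1))
            fun m _ _ => add_nonneg (lam_pos hV hK (m + 1)).le (by positivity)
    rw [Finset.sum_add_distrib] at h2
    linarith [sum_half_pow_le M]
  calc B.regret v T ≤ _ := B.regret_le_sum_epochs hν hB hV hK hbest v hT
    _ ≤ ∫ ω, (1650 * U ω
          + (100 * Λ * G + ∑ m ∈ Finset.range M, leaderCost V K Δ m + 1)) ∂P :=
        integral_mono_ae (integrable_finsetSum _ fun m _ => B.integrable_epoch_regret hV hK _ m)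
          ((hUint.const_mul _).add (integrable_const _)) hpath
    _ = 1650 * ∫ ω, U ω ∂P + (100 * Λ * G + ∑ m ∈ Finset.range M, leaderCost V K Δ m + 1) := by
        rw [integral_add (hUint.const_mul _) (integrable_const _), integral_const_mul]
        simp
    _ ≤ _ := by linarith

lemma regret_le_one (B : Play V K ν P) (hν : ∀ᵐ x ∂ν, ∀ k, x k ∈ Set.Icc (0 : ℝ) 1) (v : Fin V) :
    B.regret v 1 ≤ 1 := by
  obtain ⟨best, hbest⟩ := Finite.exists_max (mean ν)
  rw [B.regret_eq_sum hν hbest, Finset.sum_range_one]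
  have h1 := (mean_mem hν best).2
  have h2 : 0 ≤ ∫ ω, B.reward 0 ω v (B.arm 0 ω v) ∂P := by
    refine integral_nonneg_of_ae ?_
    filter_upwards [B.ae_reward_mem hν] with ω hω using (hω 0 v _).1
  linarith

lemma regret_nonpos (B : Play V K ν P) (hB : B.FollowsMABarbat) (hV : 1 ≤ V) (hK : 2 ≤ K)
    (hν : ∀ᵐ x ∂ν, ∀ k, x k ∈ Set.Icc (0 : ℝ) 1) (hgap : ∀ k, gap ν k ≤ 0) (v : Fin V) (T : ℕ) :
    B.regret v T ≤ 0 := by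
  obtain ⟨best, hbest⟩ := Finite.exists_max (mean ν)
  refine (B.regret_le_sum_epochs hν hB hV hK hbest v
    (endTime_strictMono hV hK).le_apply).trans ?_
  refine integral_nonpos fun ω => Finset.sum_nonpos fun m _ => Finset.sum_nonpos fun k _ => ?_
  have := hgap k
  rw [gap_eq hbest] at this
  exact mul_nonpos_of_nonpos_of_nonneg this
    (pullCount_pos hV hK (B.half_pow_le_state_gap m ω) k).le

end Play

/-! ### Closed form and positivity of the bound, and the final estimate -/

section Bound

variable {V K : ℕ} [NeZero K] {ν : Measure (Fin K → ℝ)}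

/-- With `0⁻¹ = 0`, arms of gap zero drop out of the sum without a case distinction. -/
lemma regretBound_eq (C : ℝ) (T : ℕ) :
    regretBound V ν C T = C / V
      + Real.log ((V : ℝ) * T) * Real.log ((K : ℝ) * V * T) / V * ∑ k, (gap ν k)⁻¹
      + (K : ℝ) * Real.log (1 / minGap ν) * Real.log ((K : ℝ) * V / minGap ν)
        / (V * minGap ν) := by
  obtain ⟨best, hbest⟩ := Finite.exists_max (mean ν)
  unfold regretBound
  congr 2
  rw [Finset.mul_sum]
  refine Finset.sum_congr rfl fun k _ => ?_
  have h0 : 0 ≤ gap ν k := by rw [gap_eq hbest]; linarith [hbest k]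
  split_ifs with h
  · rw [← div_eq_mul_inv, div_div]
  · rw [le_antisymm (not_lt.mp h) h0]
    simp

lemma sum_inv_gap_nonneg : 0 ≤ ∑ k, (gap ν k)⁻¹ := by
  obtain ⟨best, hbest⟩ := Finite.exists_max (mean ν)
  refine Finset.sum_nonneg fun k _ => inv_nonneg.mpr ?_
  rw [gap_eq hbest]
  linarith [hbest k]

variable [IsProbabilityMeasure ν]

lemma gap_le_one_of_mem (hν : ∀ᵐ x ∂ν, ∀ k, x k ∈ Set.Icc (0 : ℝ) 1) (k : Fin K) :
    gap ν k ≤ 1 := by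
  obtain ⟨best, hbest⟩ := Finite.exists_max (mean ν)
  rw [gap_eq hbest]
  linarith [(mean_mem hν best).2, (mean_mem hν k).1]

lemma minGap_term_nonneg (hV : 1 ≤ V) (hK : 2 ≤ K)
    (hν : ∀ᵐ x ∂ν, ∀ k, x k ∈ Set.Icc (0 : ℝ) 1) :
    0 ≤ (K : ℝ) * Real.log (1 / minGap ν) * Real.log ((K : ℝ) * V / minGap ν)
      / (V * minGap ν) := by
  by_cases h : ∃ k, 0 < gap ν k
  · obtain ⟨h0, k, hk⟩ := minGap_mem h
    have h1 : minGap ν ≤ 1 := hk ▸ gap_le_one_of_mem hν k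
    have h2 := two_le_mul_cast hV hK
    have h3 : 0 ≤ Real.log (1 / minGap ν) := Real.log_nonneg (by rw [le_div_iff₀ h0]; linarith)
    have h4 : 0 ≤ Real.log ((K : ℝ) * V / minGap ν) :=
      Real.log_nonneg (by rw [le_div_iff₀ h0]; linarith)
    positivity
  -- Without positive gaps the infimum over the empty set is 0, and division by zero makes the term
  -- vanish.
  · have h0 : minGap ν = 0 := by
      have : {x | 0 < x ∧ ∃ k, gap ν k = x} = ∅ := by
        ext x
        simp only [Set.mem_ofPred_eq, Set.mem_empty_iff_false, iff_false]
        rintro ⟨hx, k, rfl⟩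
        exact h ⟨k, hx⟩
      rw [minGap, this, Real.sInf_empty]
    simp [h0]

lemma one_le_sum_inv_gap (hν : ∀ᵐ x ∂ν, ∀ k, x k ∈ Set.Icc (0 : ℝ) 1)
    (h : ∃ k, 0 < gap ν k) : 1 ≤ ∑ k, (gap ν k)⁻¹ := by
  obtain ⟨best, hbest⟩ := Finite.exists_max (mean ν)
  obtain ⟨k, hk⟩ := h
  refine ((one_le_inv₀ hk).mpr (gap_le_one_of_mem hν k)).trans ?_
  refine Finset.single_le_sum (f := fun k => (gap ν k)⁻¹) (fun j _ => inv_nonneg.mpr ?_)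
    (Finset.mem_univ k)
  rw [gap_eq hbest]
  linarith [hbest j]

variable {Ω : Type*} [MeasurableSpace Ω] {P : Measure Ω} [IsProbabilityMeasure P]

lemma Play.regret_le (B : Play V K ν P) (hB : B.FollowsMABarbat) (hV : 1 ≤ V) (hK : 2 ≤ K)
    (hν : ∀ᵐ x ∂ν, ∀ k, x k ∈ Set.Icc (0 : ℝ) 1) (v : Fin V) {T : ℕ} (hT : 1 ≤ T)
    (hgap : ∃ k, 0 < gap ν k) :
    B.regret v T ≤ 10 ^ 8 * (1 + regretBound V ν (∫ ω, B.corruption T ω ∂P) T) := by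
  have hV' : (1 : ℝ) ≤ V := by exact_mod_cast hV
  have hK' : (2 : ℝ) ≤ K := by exact_mod_cast hK
  have hVT : (1 : ℝ) ≤ (V : ℝ) * T := by exact_mod_cast Nat.mul_pos hV hT
  have hKVT : (1 : ℝ) ≤ (K : ℝ) * V * T := by nlinarith
  have hlog1 := Real.log_nonneg hVT
  have hlog2 := Real.log_nonneg hKVT
  have hC : 0 ≤ ∫ ω, B.corruption T ω ∂P := integral_nonneg fun ω => B.corruption_nonneg T ω
  have hC' : 0 ≤ (∫ ω, B.corruption T ω ∂P) / V := by positivity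
  have hthird := minGap_term_nonneg hV hK hν
  have hG := one_le_sum_inv_gap hν hgap
  rw [regretBound_eq]
  have hsecond : 0 ≤ Real.log ((V : ℝ) * T) * Real.log ((K : ℝ) * V * T) / V
      * ∑ k, (gap ν k)⁻¹ := by positivity
  rcases Nat.lt_or_ge (V * T) 2 with hsmall | hbig
  -- Here `V = T = 1` and `log(VT) = 0`; the constant 1 in the bound pays for the single round.
  · have hT1 : T = 1 := by nlinarith
    subst hT1
    linarith [B.regret_le_one hν v]
  obtain ⟨best, hbest⟩ := Finite.exists_max (mean ν)
  have hex : ∃ M, T ≤ endTime V K M := ⟨T, (endTime_strictMono hV hK).le_apply⟩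
  classical
  have hM1 := Nat.find_spec hex
  have hM2 (m : ℕ) (hm : m < Nat.find hex) : endTime V K m < T :=
    not_le.mp (Nat.find_min hex hm)
  obtain ⟨hΔ0, k0, hk0⟩ := minGap_mem hgap
  have hΔ1 : minGap ν ≤ 1 := hk0 ▸ gap_le_one_of_mem hν k0
  have hmain := B.regret_le_of_epochs hB hV hK hν hbest (Δ := minGap ν)
    (fun k hk => by rw [← gap_eq hbest] at hk ⊢; exact minGap_le hk) v hM1 hM2
  have hlam := sum_lam_le hV hK hM2 hbig
  have hlead := sum_leaderCost_le hV hK hΔ0 hΔ1 (Nat.find hex)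
  simp_rw [← gap_eq hbest] at hmain
  set Λ := ∑ m ∈ Finset.range (Nat.find hex), lam V K (m + 1)
  set G := ∑ k, (gap ν k)⁻¹
  set L := Real.log ((V : ℝ) * T) * Real.log ((K : ℝ) * V * T) / V with hL
  have hL0 : 0 ≤ L := by positivity
  have h1 : Λ * G ≤ 27648 * (L * G) := by
    have := mul_le_mul_of_nonneg_right hlam (show 0 ≤ G by linarith)
    linarith
  -- The sum of the `λ` also occurs without the gap factor, from bad events; as all gaps are at most
  -- 1 and one is positive, `G ≥ 1` absorbs it.
  have h2 : L ≤ L * G := le_mul_of_one_le_right hL0 hG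
  linarith

lemma one_le_regretBound (hV : 1 ≤ V) (hK : 2 ≤ K)
    (hν : ∀ᵐ x ∂ν, ∀ k, x k ∈ Set.Icc (0 : ℝ) 1) {C : ℝ} (hC : 0 ≤ C) {T : ℕ}
    (hgap : ∃ k, 0 < gap ν k)
    (hlarge : (V : ℝ) ≤ Real.log ((V : ℝ) * T) * Real.log ((K : ℝ) * V * T)) :
    1 ≤ regretBound V ν C T := by
  have hV' : (0 : ℝ) < V := by positivity
  have hthird := minGap_term_nonneg hV hK hν
  have hG := one_le_sum_inv_gap hν hgap
  rw [regretBound_eq]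
  have h1 : 1 ≤ Real.log ((V : ℝ) * T) * Real.log ((K : ℝ) * V * T) / V := by
    rwa [one_le_div hV']
  have h2 : 0 ≤ C / V := by positivity
  nlinarith

lemma regretBound_nonneg (hV : 1 ≤ V) (hK : 2 ≤ K)
    (hν : ∀ᵐ x ∂ν, ∀ k, x k ∈ Set.Icc (0 : ℝ) 1) {C : ℝ} (hC : 0 ≤ C) {T : ℕ} (hT : 1 ≤ T) :
    0 ≤ regretBound V ν C T := by
  have hV' : (1 : ℝ) ≤ V := by exact_mod_cast hV
  have hK' : (2 : ℝ) ≤ K := by exact_mod_cast hK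
  have hVT : (1 : ℝ) ≤ (V : ℝ) * T := by exact_mod_cast Nat.mul_pos hV hT
  have hKVT : (1 : ℝ) ≤ (K : ℝ) * V * T := by nlinarith
  have hlog1 := Real.log_nonneg hVT
  have hlog2 := Real.log_nonneg hKVT
  have hthird := minGap_term_nonneg hV hK hν
  have hG := sum_inv_gap_nonneg (ν := ν)
  rw [regretBound_eq]
  positivity

end Bound

end MABarbat

end

theorem theorem2 :
    (∀ V K T : ℕ, 1 ≤ V → 2 ≤ K → 1 ≤ T →
      (MABarbat.commCost V K T : ℝ) ≤ V * Real.log ((V : ℝ) * T)) ∧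
    ∃ c : ℝ, 0 < c ∧
      ∀ (V K : ℕ) [NeZero K], 1 ≤ V → 2 ≤ K →
      ∀ (ν : MeasureTheory.Measure (Fin K → ℝ)) [MeasureTheory.IsProbabilityMeasure ν],
      (∀ᵐ x ∂ν, ∀ k, x k ∈ Set.Icc (0 : ℝ) 1) →
      ∀ (Ω : Type*) [MeasurableSpace Ω] (P : MeasureTheory.Measure Ω)
        [MeasureTheory.IsProbabilityMeasure P]
        (B : MABarbat.Play V K ν P), B.FollowsMABarbat →
      ∀ (v : Fin V) (T : ℕ), 1 ≤ T →
        B.regret v T ≤ c * (1 + MABarbat.regretBound V ν (∫ ω, B.corruption T ω ∂P) T) ∧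
        ((V : ℝ) ≤ Real.log ((V : ℝ) * T) * Real.log ((K : ℝ) * V * T) →
          B.regret v T ≤ c * MABarbat.regretBound V ν (∫ ω, B.corruption T ω ∂P) T) := by
  -- The factor 2 serves the large-`T` claim: there the bound is at least 1, so `1 + regretBound` is
  -- at most twice `regretBound`.
  refine ⟨fun V K T hV hK hT => MABarbat.commCost_le hV hK hT, 2 * 10 ^ 8, by norm_num, ?_⟩
  intro V K _ hV hK ν _ hν Ω _ P _ B hB v T hT
  have hC : 0 ≤ ∫ ω, B.corruption T ω ∂P := integral_nonneg fun ω => B.corruption_nonneg T ω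
  have hnn := MABarbat.regretBound_nonneg hV hK hν hC hT
  by_cases hgap : ∃ k, 0 < MABarbat.gap ν k
  · have h := B.regret_le hB hV hK hν v hT hgap
    refine ⟨by linarith, fun hlarge => ?_⟩
    have := MABarbat.one_le_regretBound hV hK hν hC hgap hlarge
    linarith
  · have h := B.regret_nonpos hB hV hK hν (fun k => not_lt.mp fun hk => hgap ⟨k, hk⟩) v T
    exact ⟨by linarith, fun _ => by linarith⟩
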